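/- **Setting.** Let $d\in\mathbb N_0$, let $\mathfrak L^-$ be a finite set and $\mathfrak L=\mathfrak L^-\sqcup\{0\}$. Fix a scaling $\mathfrak s=(\mathfrak s_1,\dots,\mathfrak s_d)\in[1,\infty)^d$, numbers $\eta>0$, $\alpha_{\mathfrak l},\mathrm{reg}(\mathfrak l)\in\mathbb R$ ($\mathfrak l\in\mathfrak L$) with $\alpha_0=0$ and $\mathrm{reg}(\mathfrak l)<\alpha_{\mathfrak l}$, and $r\in\mathbb R$ (the expected regularity of the solution) with $r\le \mathfrak s_i$ for all $i$. For $\mathbf n\in\mathbb N_0^d$ let $|\mathbf n|=\sum_i\mathfrak s_i\mathbf n(i)$. $M(I)$ denotes the set of finitely supported maps $I\to\mathbb N_0$, with unit vectors $e_\iota$, $\iota\in I$, and component-wise order. **Multi-indices.** Let $\mathcal R=(\mathfrak L\times M(\mathbb N_0^d))\sqcup\mathbb N_0^d$, with variables $\mathsf z_{(\mathfrak l,k)},\mathsf z_{\mathbf n}$. A pair $(\mathfrak l,k)$ is subcritical if $r<\eta+\mathrm{reg}(\mathfrak l)$ and, for all $0\neq k'\le k$, both $r<\eta+\sum_{\mathbf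 n}(r-|\mathbf n|)k'(\mathbf n)$ and $r<\eta+\mathrm{reg}(\mathfrak l)+\sum_{\mathbf n}(r-|\mathbf n|)k'(\mathbf n)$. For $\beta\in M(\mathcal R)$ put $$[\beta]=\sum_{(\mathfrak l,k)}\Big(1-\sum_{\mathbf n}k(\mathbf n)\Big)\beta(\mathfrak l,k)+\sum_{\mathbf n}\beta(\mathbf n),\qquad |\beta|=\sum_{(\mathfrak l,k)}\Big(\alpha_{\mathfrak l}+\sum_{\mathbf n}(\eta-|\mathbf n|)k(\mathbf n)\Big)\beta(\mathfrak l,k)+\sum_{\mathbf n}(|\mathbf n|-\eta)\beta(\mathbf n).$$ Let $\mathcal N_-$ be the set of $\beta$ with $[\beta]=1$, with $(\mathfrak l,k)$ subcritical whenever $\beta(\mathfrak l,k)\ne0$, and with $\beta(\mathbf n)=0$ whenever $|\mathbf n|<r$. Let $\mathcal N$ be the set of $\beta\in\mathcal N_-$ with $\sum_{\mathfrak l\in\mathfrak L^-}\sum_k\beta(\mathfrak l,k)>0$, let $\mathcal P=\{e_{\mathbf n}\}_{\mathbf n\in\mathbb N_0^d}$, and $\overline{\mathcal N}=\mathcal P\sqcup\mathcal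 N$. For a set $\mathcal V$ of multi-indices, $T_{\mathcal V}$ is the real vector space with basis $\{\mathsf z_\beta\}_{\beta\in\mathcal V}$. **Generators.** On $\mathbb R[\mathcal R]$ let $D^{(\mathbf n)}$ be the derivation with $D^{(\mathbf n)}\mathsf z_{(\mathfrak l,k)}=(k(\mathbf n)+1)\mathsf z_{(\mathfrak l,k+e_{\mathbf n})}$ if $(\mathfrak l,k+e_{\mathbf n})$ is subcritical and $=0$ otherwise, and $D^{(\mathbf n)}\mathsf z_{\mathbf m}=\delta_{\mathbf m\mathbf n}$; let $\boldsymbol\partial_i=\sum_{\mathbf n}(\mathbf n(i)+1)\mathsf z_{\mathbf n+e_i}D^{(\mathbf n)}$ (on each variable the sum is finite). Let $\mathcal M=\mathcal N\times\mathbb N_0^d$, let $L$ be the Lie algebra of derivations generated by $\{\mathsf z^\gamma D^{(\mathbf n)}\}_{(\gamma,\mathbf n)\in\mathcal M}\cup\{\boldsymbol\partial_i\}_{i=1}^d$, $\mathrm U(L)$ its universal enveloping algebra, and $\rho$ the action of $\mathrm U(L)$ on $\mathbb R[\mathcal R]$ that extends the action of the derivations. The linear maps $U\mapsto\mathsf z^\gamma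 U D^{(\mathbf n)}$ on $\mathrm U(L)$ are determined by $\mathsf z^\gamma 1D^{(\mathbf n)}=\mathsf z^\gamma D^{(\mathbf n)}$ and, for $E\in L$ with $E\mathsf z^\gamma=\sum_\beta E_\beta^\gamma \mathsf z^\beta$, by $\mathsf z^\gamma (EU) D^{(\mathbf n)}=E\,(\mathsf z^\gamma U D^{(\mathbf n)})-\sum_\beta E^\gamma_\beta\, \mathsf z^\beta U D^{(\mathbf n)}$; they commute. For $J\in M(\mathcal M)$, $\mathbf m\in\mathbb N_0^d$, let $\mathsf D_{(J,\mathbf m)}\in\mathrm U(L)$ be $\frac1{J!\,\mathbf m!}$ times the result of applying to $\boldsymbol\partial^{\mathbf m}=\prod_i\boldsymbol\partial_i^{\mathbf m(i)}$ each map $U\mapsto\mathsf z^\gamma UD^{(\mathbf n)}$ exactly $J(\gamma,\mathbf n)$ times, and define the coefficients $(\mathsf D_{(J,\mathbf m)})_\beta^\gamma$ by $\rho(\mathsf D_{(J,\mathbf m)})\mathsf z^\gamma=\sum_\beta(\mathsf D_{(J,\mathbf m)})_\beta^\gamma\,\mathsf z^\beta$. **Coaction.** Let $\mathcal M^+=\{(\gamma,\mathbf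 n)\in\mathcal M: |\mathbf n|<\eta+|\gamma|\}$ and $T^+=\mathbb R[\mathcal M^+\sqcup\{1,\dots,d\}]$, with monomials $\mathsf Z^{(J,\mathbf m)}$, $J\in M(\mathcal M^+)$, $\mathbf m\in\mathbb N_0^d$. Let $$\Delta^+\mathsf z_\beta=\sum_{J\in M(\mathcal M^+),\,\mathbf m\in\mathbb N_0^d,\,\gamma\in\overline{\mathcal N}\cup\mathcal N_-}(\mathsf D_{(J,\mathbf m)})_\beta^\gamma\;\mathsf Z^{(J,\mathbf m)}\otimes\mathsf z_\gamma,\qquad \beta\in\overline{\mathcal N}\cup\mathcal N_-,$$ and let $\overline{\Delta^+}:T_{\overline{\mathcal N}}\to T^+\otimes T_{\overline{\mathcal N}}$ be the restriction of $\Delta^+$ to $T_{\overline{\mathcal N}}$ followed by the projection of the second tensor factor onto $T_{\overline{\mathcal N}}$ (which discards the $\mathsf z_\gamma$ with $\gamma\notin\overline{\mathcal N}$). For a character (unital algebra morphism) $\boldsymbol\pi:T^+\to\mathbb R$ put $\Gamma^+_{\boldsymbol\pi}=(\boldsymbol\pi\otimes\mathrm{id})\overline{\Delta^+}\in\mathrm{End}(T_{\overline{\mathcal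 N}})$. **Statement.** For every $\beta\in\overline{\mathcal N}\cup\mathcal N_-$ only finitely many terms of $\Delta^+\mathsf z_\beta$ are non-zero, so that these maps are well-defined, and $$G=\{\Gamma^+_{\boldsymbol\pi}: \boldsymbol\pi \text{ a character of } T^+\}$$ is a group under composition and a structure group on $T_{\overline{\mathcal N}}$. That is: the set $A=\{|\beta|:\beta\in\mathcal N_-\}\cup\{|\beta|+\eta:\beta\in\overline{\mathcal N}\}\subset\mathbb R$ is bounded from below and locally finite; $T_{\overline{\mathcal N}}=\bigoplus_{\nu\in A}T_\nu$ where $T_\nu$ is the span of the $\mathsf z_\beta$, $\beta\in\overline{\mathcal N}$, with $|\beta|+\eta=\nu$; $G$ is a group of linear endomorphisms of $T_{\overline{\mathcal N}}$; and $\Gamma a-a\in\bigoplus_{\nu'<\nu}T_{\nu'}$ for all $\Gamma\in G$, $\nu\in A$, $a\in T_\nu$. Moreover, for every character $\boldsymbol\pi$ and all $\beta,\gamma\in\overline{\mathcal N}$, with $(\Gamma^+_{\boldsymbol\pi}-\mathrm{id})_\beta^\gamma$ the coefficient of $\mathsf z_\gamma$ in $(\Gamma^+_{\boldsymbol\pi}-\mathrm{id})\mathsf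 z_\beta$, $$(\Gamma^+_{\boldsymbol\pi}-\mathrm{id})_\beta^\gamma\neq0\ \Longrightarrow\ |\gamma|<|\beta|.$$ -/

import Mathlib

open scoped TensorProduct Nat

attribute [local instance 100] LieRing.ofAssociativeRing LieAlgebra.ofAssociativeAlgebra

noncomputable section

namespace MultiIndexRS

/-- Multi-indices over `I`: finitely supported maps `I → ℕ`. -/
abbrev MI (I : Type*) := I →₀ ℕ

/-- Indices of the coordinates `z_(l,k)` (left) and `z_n` (right).
`Option Λ` is the index set of the noises, with `none` for the additional index `0` of the
trivial noise `ξ₀ = 1`. -/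
abbrev Coord (d : ℕ) (Λ : Type*) := (Option Λ × MI (Fin d → ℕ)) ⊕ (Fin d → ℕ)

/-- The scaling data: the scaling `s` of `ℝ^d`, the order `η` of the operator, the homogeneities
`α` of the noises, and the regularities `reg`, `regsol` which define subcriticality.
The last field says that `|n| < regsol` happens for `n = 0` at most. -/
structure Setting (d : ℕ) (Λ : Type*) where
  s : Fin d → ℝ
  one_le_s : ∀ i, 1 ≤ s i
  η : ℝ
  η_pos : 0 < η
  α : Option Λ → ℝ
  α_none : α none = 0
  reg : Option Λ → ℝ
  reg_lt : ∀ l, reg l < α l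
  regsol : ℝ
  regsol_le : ∀ i, regsol ≤ s i

/-- The algebra of polynomials in the coordinates. -/
abbrev Poly (d : ℕ) (Λ : Type*) := MvPolynomial (Coord d Λ) ℝ

variable {d : ℕ} {Λ : Type*}

/-- `[β] = ∑ (1 - length k) β(l,k) + ∑ β(n)`. -/
def bracket (β : MI (Coord d Λ)) : ℤ :=
  β.sum fun x b => (b : ℤ) * Sum.elim (fun lk => 1 - ((lk.2.sum fun _ j => j : ℕ) : ℤ)) (fun _ => 1) x

/-- The noise homogeneity: the sum of `β(l,k)` over all `l ≠ 0` and all `k`. -/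
def noiseHom (β : MI (Coord d Λ)) : ℕ :=
  β.sum fun x b => b * Sum.elim (fun lk => if lk.1.isSome then 1 else 0) (fun _ => 0) x

namespace Setting

variable (S : Setting d Λ)

/-- The scaled degree `|n| = ∑ sᵢ n(i)`. -/
def deg (n : Fin d → ℕ) : ℝ := ∑ i, S.s i * n i

/-- The homogeneity `|β|`. -/
def hom (β : MI (Coord d Λ)) : ℝ :=
  β.sum fun x b => (b : ℝ) *
    Sum.elim (fun lk => S.α lk.1 + lk.2.sum fun n j => (S.η - S.deg n) * j)
      (fun n => S.deg n - S.η) x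

/-- `regsol < η + min {reg l, min_{0<k'≤k} ∑ (regsol - |n|) k'(n),
reg l + min_{0<k'≤k} ∑ (regsol - |n|) k'(n)}`. -/
def Subcritical (l : Option Λ) (k : MI (Fin d → ℕ)) : Prop :=
  S.regsol < S.η + S.reg l ∧
    ∀ k' : MI (Fin d → ℕ), k' ≠ 0 → k' ≤ k →
      S.regsol < S.η + (k'.sum fun n j => (S.regsol - S.deg n) * j) ∧
      S.regsol < S.η + (S.reg l + k'.sum fun n j => (S.regsol - S.deg n) * j)

/-- The large set `N₋` of multi-indices. -/
def NMin : Set (MI (Coord d Λ)) :=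
  {β | bracket β = 1 ∧ (∀ l k, β (Sum.inl (l, k)) ≠ 0 → S.Subcritical l k) ∧
    ∀ n, S.deg n < S.regsol → β (Sum.inr n) = 0}

/-- The multi-indices in `N₋` which contain a noise. -/
def N : Set (MI (Coord d Λ)) := {β | β ∈ S.NMin ∧ 0 < noiseHom β}

/-- The purely polynomial multi-indices `e_n`. -/
def P (d : ℕ) (Λ : Type*) : Set (MI (Coord d Λ)) :=
  Set.range fun n => Finsupp.single (Sum.inr n) 1

/-- The populated multi-indices `P ⊔ N`. -/
def Pop : Set (MI (Coord d Λ)) := P d Λ ∪ S.N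

open Classical in
/-- The derivation `D^(n)`, restricted to subcritical pairs:
`D^(n) z_(l,k) = (k(n)+1) z_(l,k+e_n)` if `(l,k+e_n)` is subcritical, and `0` otherwise;
`D^(n) z_m = δ_{mn}`. -/
def D (n : Fin d → ℕ) : Derivation ℝ (Poly d Λ) (Poly d Λ) :=
  MvPolynomial.mkDerivation ℝ <| Sum.elim
    (fun lk => if S.Subcritical lk.1 (lk.2 + Finsupp.single n 1) then
      ((lk.2 n : ℝ) + 1) • MvPolynomial.X (Sum.inl (lk.1, lk.2 + Finsupp.single n 1)) else 0)
    (fun m => if m = n then 1 else 0)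

/-- The derivation `∂ᵢ = ∑_n (n(i)+1) z_{n+eᵢ} D^(n)`. On each coordinate only finitely many `n`
contribute, since a subcritical `(l,k+e_n)` has `|n| < η`. -/
def dx (i : Fin d) : Derivation ℝ (Poly d Λ) (Poly d Λ) :=
  MvPolynomial.mkDerivation ℝ fun x => ∑ᶠ n : Fin d → ℕ,
    ((n i : ℝ) + 1) • (MvPolynomial.X (Sum.inr (n + Pi.single i 1)) * S.D n (MvPolynomial.X x))

/-- The generators `z^γ D^(n)` with `γ ∈ N`, and `∂ᵢ`. -/
def gens : Set (Derivation ℝ (Poly d Λ) (Poly d Λ)) :=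
  {E | ∃ γ ∈ S.N, ∃ n, E = MvPolynomial.monomial γ (1 : ℝ) • S.D n} ∪ Set.range S.dx

/-- The Lie algebra `L` generated by the generators. -/
abbrev L : LieSubalgebra ℝ (Derivation ℝ (Poly d Λ) (Poly d Λ)) :=
  LieSubalgebra.lieSpan ℝ _ S.gens

/-- The universal enveloping algebra of `L`. -/
abbrev UL := UniversalEnvelopingAlgebra ℝ S.L

/-- The linear span of the monomials `z^γ`, `γ ∈ N`. -/
abbrev TN : Submodule ℝ (Poly d Λ) := MvPolynomial.restrictSupport ℝ S.N

/-! ### `L` maps `TN` to itself -/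

theorem monomial_mem {γ : MI (Coord d Λ)} (h : γ ∈ S.N) (c : ℝ) :
    MvPolynomial.monomial γ c ∈ S.TN := by
  rw [MvPolynomial.mem_restrictSupport_iff]
  intro x hx
  have := MvPolynomial.support_monomial_subset hx
  simp only [Finset.mem_singleton] at this
  exact this ▸ h

theorem mem_N_iff (β : MI (Coord d Λ)) : β ∈ S.N ↔ bracket β = 1 ∧ 0 < noiseHom β ∧
    (∀ l k, β (Sum.inl (l, k)) ≠ 0 → S.Subcritical l k) ∧
    ∀ n, S.deg n < S.regsol → β (Sum.inr n) = 0 := by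
  simp only [N, NMin, Set.mem_ofPred_eq]; tauto

theorem bracket_add (β γ : MI (Coord d Λ)) : bracket (β + γ) = bracket β + bracket γ := by
  classical
  unfold bracket
  rw [Finsupp.sum_add_index'] <;> intros <;> push_cast <;> ring

theorem noiseHom_add (β γ : MI (Coord d Λ)) : noiseHom (β + γ) = noiseHom β + noiseHom γ := by
  classical
  unfold noiseHom
  rw [Finsupp.sum_add_index'] <;> intros <;> ring

theorem bracket_inl (l : Option Λ) (k : MI (Fin d → ℕ)) :
    bracket (Finsupp.single (Sum.inl (l, k)) 1) = 1 - ((k.sum fun _ j => j : ℕ) : ℤ) := by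
  simp [bracket]

theorem bracket_inr (n : Fin d → ℕ) :
    bracket (Finsupp.single (Sum.inr n : Coord d Λ) 1) = 1 := by
  simp [bracket]

theorem noiseHom_inl (l : Option Λ) (k k' : MI (Fin d → ℕ)) :
    noiseHom (Finsupp.single (Sum.inl (l, k) : Coord d Λ) 1) =
      noiseHom (Finsupp.single (Sum.inl (l, k') : Coord d Λ) 1) := by
  simp [noiseHom]

theorem noiseHom_inr (n : Fin d → ℕ) :
    noiseHom (Finsupp.single (Sum.inr n : Coord d Λ) 1) = 0 := by
  simp [noiseHom]

theorem length_add_single (k : MI (Fin d → ℕ)) (n : Fin d → ℕ) :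
    ((k + Finsupp.single n 1).sum fun _ j => j) = (k.sum fun _ j => j) + 1 := by
  classical
  rw [Finsupp.sum_add_index'] <;> simp

/-- Replacing `(l,k)` by `(l,k+e_n)` and multiplying by `z^μ` with `[μ] = 1`. -/
theorem mem_N_of_inl {δ μ : MI (Coord d Λ)} {l : Option Λ} {k : MI (Fin d → ℕ)} {n : Fin d → ℕ}
    (h : δ + Finsupp.single (Sum.inl (l, k)) 1 ∈ S.N) (hμ : bracket μ = 1)
    (hs : ∀ l k, μ (Sum.inl (l, k)) ≠ 0 → S.Subcritical l k)
    (hn : ∀ n, S.deg n < S.regsol → μ (Sum.inr n) = 0)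
    (hk : S.Subcritical l (k + Finsupp.single n 1)) :
    μ + δ + Finsupp.single (Sum.inl (l, k + Finsupp.single n 1)) 1 ∈ S.N := by
  classical
  rw [mem_N_iff] at h ⊢
  obtain ⟨h1, h2, h3, h4⟩ := h
  rw [bracket_add, bracket_inl] at h1
  rw [noiseHom_add] at h2
  refine ⟨?_, ?_, ?_, ?_⟩
  · rw [bracket_add, bracket_add, bracket_inl, length_add_single, hμ, Nat.cast_add, Nat.cast_one]
    linarith
  · rw [noiseHom_add, noiseHom_add, noiseHom_inl l _ k]; omega
  · intro l' k' h'
    by_cases hμ' : μ (Sum.inl (l', k')) = 0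
    · by_cases hδ : δ (Sum.inl (l', k')) = 0
      · simp only [Finsupp.add_apply, hμ', hδ, Finsupp.single_apply] at h'
        split_ifs at h' with he
        · simp only [Sum.inl.injEq, Prod.mk.injEq] at he
          rw [← he.1, ← he.2]; exact hk
        · simp at h'
      · exact h3 _ _ (by simp [hδ])
    · exact hs _ _ hμ'
  · intro n' hn'
    have := h4 n' hn'
    simp only [Finsupp.add_apply] at this
    simp only [Finsupp.add_apply, hn n' hn', Finsupp.single_apply, reduceCtorEq, if_false]
    omega

/-- Removing `e_n` and multiplying by `z^μ` with `[μ] = 1`. -/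
theorem mem_N_of_inr {δ μ : MI (Coord d Λ)} {n : Fin d → ℕ}
    (h : δ + Finsupp.single (Sum.inr n) 1 ∈ S.N) (hμ : bracket μ = 1)
    (hs : ∀ l k, μ (Sum.inl (l, k)) ≠ 0 → S.Subcritical l k)
    (hn : ∀ n, S.deg n < S.regsol → μ (Sum.inr n) = 0) : μ + δ ∈ S.N := by
  classical
  rw [mem_N_iff] at h ⊢
  obtain ⟨h1, h2, h3, h4⟩ := h
  rw [bracket_add, bracket_inr] at h1
  rw [noiseHom_add, noiseHom_inr] at h2
  refine ⟨?_, ?_, ?_, ?_⟩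
  · rw [bracket_add, hμ]; linarith
  · rw [noiseHom_add]; omega
  · intro l' k' h'
    by_cases hμ' : μ (Sum.inl (l', k')) = 0
    · refine h3 _ _ ?_
      simp only [Finsupp.add_apply] at h' ⊢
      omega
    · exact hs _ _ hμ'
  · intro n' hn'
    have := h4 n' hn'
    simp only [Finsupp.add_apply] at this
    simp only [Finsupp.add_apply, hn n' hn']
    omega

/-- `z^μ D^(n)` maps the coordinate `x`, multiplied by `z^δ`, to `TN`. -/
theorem D_X_mem {δ μ : MI (Coord d Λ)} {x : Coord d Λ} (n : Fin d → ℕ)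
    (h : δ + Finsupp.single x 1 ∈ S.N) (hμ : bracket μ = 1)
    (hs : ∀ l k, μ (Sum.inl (l, k)) ≠ 0 → S.Subcritical l k)
    (hn : ∀ n, S.deg n < S.regsol → μ (Sum.inr n) = 0) (c : ℝ) :
    MvPolynomial.monomial (μ + δ) c * S.D n (MvPolynomial.X x) ∈ S.TN := by
  classical
  rcases x with ⟨l, k⟩ | m
  · simp only [D, MvPolynomial.mkDerivation_X, Sum.elim_inl]
    split_ifs with hk
    · rw [mul_smul_comm, MvPolynomial.X, MvPolynomial.monomial_mul]
      exact Submodule.smul_mem _ _ (S.monomial_mem (S.mem_N_of_inl h hμ hs hn hk) _)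
    · simp
  · simp only [D, MvPolynomial.mkDerivation_X, Sum.elim_inr]
    split_ifs with hm
    · rw [mul_one]
      exact S.monomial_mem (S.mem_N_of_inr h hμ hs hn) _
    · simp

theorem deriv_mem (E : Derivation ℝ (Poly d Λ) (Poly d Λ))
    (hE : ∀ (δ : MI (Coord d Λ)) (x : Coord d Λ), δ + Finsupp.single x 1 ∈ S.N → ∀ c : ℝ,
      MvPolynomial.monomial δ c * E (MvPolynomial.X x) ∈ S.TN)
    {f : Poly d Λ} (hf : f ∈ S.TN) : E f ∈ S.TN := by
  classical
  rw [MvPolynomial.as_sum f, map_sum]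
  refine Submodule.sum_mem _ fun γ hγ => ?_
  have hγN : γ ∈ S.N := (MvPolynomial.mem_restrictSupport_iff _).1 hf hγ
  have hE' : E = MvPolynomial.mkDerivation ℝ fun x => E (MvPolynomial.X x) :=
    MvPolynomial.derivation_ext fun x => by rw [MvPolynomial.mkDerivation_X]
  rw [hE', MvPolynomial.mkDerivation_monomial]
  refine Submodule.smul_mem _ _ (Submodule.sum_mem _ fun x hx => ?_)
  simp only [smul_eq_mul]
  refine hE _ _ ?_ _
  have : γ - Finsupp.single x 1 + Finsupp.single x 1 = γ := by
    refine tsub_add_cancel_of_le ?_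
    rw [Finsupp.single_le_iff]
    exact Nat.one_le_iff_ne_zero.2 (Finsupp.mem_support_iff.1 hx)
  rwa [this]

theorem deg_add (n : Fin d → ℕ) (i : Fin d) : S.s i ≤ S.deg (n + Pi.single i 1) := by
  classical
  unfold deg
  have h0 : ∀ j ∈ Finset.univ, 0 ≤ S.s j * ((n + Pi.single i 1 : Fin d → ℕ) j : ℝ) :=
    fun j _ => mul_nonneg (zero_le_one.trans (S.one_le_s j)) (Nat.cast_nonneg _)
  refine le_trans ?_ (Finset.single_le_sum h0 (Finset.mem_univ i))
  have : (1 : ℝ) ≤ ((n + Pi.single i 1 : Fin d → ℕ) i : ℝ) := by simp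
  nlinarith [S.one_le_s i]

theorem gens_mem {E : Derivation ℝ (Poly d Λ) (Poly d Λ)} (hE : E ∈ S.gens)
    {f : Poly d Λ} (hf : f ∈ S.TN) : E f ∈ S.TN := by
  classical
  rcases hE with ⟨γ, hγ, n, rfl⟩ | ⟨i, rfl⟩
  · refine S.deriv_mem _ (fun δ x h c => ?_) hf
    obtain ⟨h1, -, h3, h4⟩ := (S.mem_N_iff γ).1 hγ
    have := S.D_X_mem (x := x) n h h1 h3 h4 c
    rwa [Derivation.smul_apply, smul_eq_mul, ← mul_assoc, MvPolynomial.monomial_mul, mul_one,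
      add_comm δ γ]
  · refine S.deriv_mem _ (fun δ x h c => ?_) hf
    rw [dx, MvPolynomial.mkDerivation_X]
    refine finsum_induction (fun p => MvPolynomial.monomial δ c * p ∈ S.TN) (by simp)
      (fun p q hp hq => by rw [mul_add]; exact Submodule.add_mem _ hp hq) (fun n => ?_)
    rw [mul_smul_comm, ← mul_assoc, MvPolynomial.X, MvPolynomial.monomial_mul, mul_one, add_comm δ]
    refine Submodule.smul_mem _ _ (S.D_X_mem (x := x) n h (bracket_inr _) ?_ ?_ c)
    · intro l k h'
      simp at h'
    · intro m hm
      rw [Finsupp.single_apply, if_neg]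
      rintro h'
      rw [Sum.inr.injEq] at h'
      subst h'
      exact absurd hm (not_lt.2 ((S.regsol_le i).trans (S.deg_add n i)))

theorem L_mem {E : Derivation ℝ (Poly d Λ) (Poly d Λ)} (hE : E ∈ S.L) :
    ∀ {f : Poly d Λ}, f ∈ S.TN → E f ∈ S.TN := by
  induction hE using LieSubalgebra.lieSpan_induction with
  | mem x hx => exact fun hf => S.gens_mem hx hf
  | zero => intro f _; simp
  | smul a x _ h => intro f hf; simpa using Submodule.smul_mem _ a (h hf)
  | add x y _ _ hx hy => intro f hf; simpa using Submodule.add_mem _ (hx hf) (hy hf)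
  | lie x y _ _ hx hy =>
    intro f hf
    rw [Derivation.commutator_apply]
    exact Submodule.sub_mem _ (hx (hy hf)) (hy (hx hf))

theorem smul_D_mem (n : Fin d → ℕ) {f : Poly d Λ} (hf : f ∈ S.TN) : f • S.D n ∈ S.L := by
  rw [MvPolynomial.as_sum f, Finset.sum_smul]
  refine Submodule.sum_mem S.L.toSubmodule fun γ hγ => ?_
  have hγN : γ ∈ S.N := (MvPolynomial.mem_restrictSupport_iff _).1 hf hγ
  have : MvPolynomial.monomial γ (f.coeff γ) • S.D n =
      f.coeff γ • (MvPolynomial.monomial γ (1 : ℝ) • S.D n) := by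
    rw [← smul_assoc, MvPolynomial.smul_monomial, smul_eq_mul, mul_one]
  rw [this]
  exact Submodule.smul_mem _ _ (LieSubalgebra.subset_lieSpan (Or.inl ⟨γ, hγN, n, rfl⟩))

/-! ### The universal enveloping algebra, its action and its basis -/

/-- `∂ᵢ` as an element of `L`. -/
def dxL (i : Fin d) : S.L := ⟨S.dx i, LieSubalgebra.subset_lieSpan (Or.inr ⟨i, rfl⟩)⟩

/-- The linear map `f ↦ f D^(n)` from `TN` to the universal enveloping algebra. -/
def smulD (n : Fin d → ℕ) : S.TN →ₗ[ℝ] S.UL :=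
  (UniversalEnvelopingAlgebra.ι ℝ : S.L →ₗ⁅ℝ⁆ S.UL).toLinearMap ∘ₗ
    { toFun := fun f => (⟨(f : Poly d Λ) • S.D n, S.smul_D_mem n f.2⟩ : S.L)
      map_add' := fun f g => Subtype.ext (by simp [add_smul])
      map_smul' := fun c f => Subtype.ext (by simp) }

/-- The action of `L` on `TN`. -/
def actTN (E : S.L) : S.TN →ₗ[ℝ] S.TN :=
  (E : Derivation ℝ (Poly d Λ) (Poly d Λ)).toLinearMap.restrict fun _ hf => S.L_mem E.2 hf

/-- The action `E · u = (f ↦ E u(f) - u(E f))` of `L` on linear maps from `TN` to its universal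
enveloping algebra. -/
def leibnizAction : S.L →ₗ⁅ℝ⁆ Module.End ℝ (S.TN →ₗ[ℝ] S.UL) where
  toFun E :=
    { toFun := fun u =>
        LinearMap.mulLeft ℝ (UniversalEnvelopingAlgebra.ι ℝ E : S.UL) ∘ₗ u - u ∘ₗ S.actTN E
      map_add' := fun u v => by ext f; simp [mul_add]; abel
      map_smul' := fun c u => by ext f; simp [smul_sub] }
  map_add' E F := by
    ext u f
    have : S.actTN (E + F) f = S.actTN E f + S.actTN F f := Subtype.ext (by simp [actTN])
    simp [add_mul, this]; abel
  map_smul' c E := by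
    ext u f
    have : S.actTN (c • E) f = c • S.actTN E f := Subtype.ext (by simp [actTN])
    simp [this, smul_sub]
  map_lie' {E F} := by
    ext u f
    have : S.actTN ⁅E, F⁆ f = S.actTN E (S.actTN F f) - S.actTN F (S.actTN E f) :=
      Subtype.ext (by simp [actTN, LieRing.of_associative_ring_bracket])
    simp [this, LieRing.of_associative_ring_bracket, sub_mul, mul_sub, mul_assoc]
    abel

/-- `insertD n U f` is the element `f U D^(n)`. It is determined by `f 1 D^(n) = f D^(n)` and
`f (E U) D^(n) = E (f U D^(n)) - (E f) U D^(n)` for `E ∈ L`. -/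
def insertD (n : Fin d → ℕ) (U : S.UL) : S.TN →ₗ[ℝ] S.UL :=
  UniversalEnvelopingAlgebra.lift ℝ S.leibnizAction U (S.smulD n)

theorem insertD_one (n : Fin d → ℕ) (f : S.TN) : S.insertD n 1 f = S.smulD n f := by
  simp [insertD]

theorem insertD_ι_mul (n : Fin d → ℕ) (E : S.L) (U : S.UL) (f : S.TN) :
    S.insertD n (UniversalEnvelopingAlgebra.ι ℝ E * U) f =
      UniversalEnvelopingAlgebra.ι ℝ E * S.insertD n U f - S.insertD n U (S.actTN E f) := by
  simp [insertD, leibnizAction]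

/-- The index set `N × ℕ^d` of the generators `z^γ D^(n)`. -/
abbrev M := S.N × (Fin d → ℕ)

/-- The map `U ↦ z^γ U D^(n)`. -/
def insertGen (p : S.M) (U : S.UL) : S.UL :=
  S.insertD p.2 U ⟨MvPolynomial.monomial p.1.1 1, S.monomial_mem p.1.2 1⟩

/-- `∂^m = ∏ᵢ ∂ᵢ^{m(i)}`; the factors commute. -/
def dxPow (m : Fin d → ℕ) : S.UL :=
  (List.ofFn fun i => (UniversalEnvelopingAlgebra.ι ℝ (S.dxL i) : S.UL) ^ m i).prod

/-- The basis element
`D_(J,m) = 1/(J! m!) ∏ (z^γ)^{J(γ,n)} ∂^m ∏ (D^(n))^{J(γ,n)}`, obtained from `∂^m` by applying each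
of the commuting maps `U ↦ z^γ U D^(n)` exactly `J(γ,n)` times. -/
def DJm (J : MI S.M) (m : Fin d → ℕ) : S.UL :=
  (((J.prod fun _ j => j !) * ∏ i, (m i)! : ℕ) : ℝ)⁻¹ •
    (Finsupp.toMultiset J).toList.foldr S.insertGen (S.dxPow m)

/-- The action of `U(L)` on polynomials which extends the action of the derivations. -/
def rho : S.UL →ₐ[ℝ] Module.End ℝ (Poly d Λ) :=
  UniversalEnvelopingAlgebra.lift ℝ
    { toFun := fun E => (E : Derivation ℝ (Poly d Λ) (Poly d Λ)).toLinearMap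
      map_add' := fun _ _ => rfl
      map_smul' := fun _ _ => rfl
      map_lie' := fun {_ _} => Derivation.commutator_coe_linear_map }

/-- The coefficient `(D_(J,m))_β^γ`, that is, `ρ(D_(J,m)) z^γ = ∑_β (D_(J,m))_β^γ z^β`. -/
def actCoeff (J : MI S.M) (m : Fin d → ℕ) (β γ : MI (Coord d Λ)) : ℝ :=
  (S.rho (S.DJm J m) (MvPolynomial.monomial γ 1)).coeff β

/-! ### The coaction and the structure group -/

/-- The pairs `(γ,n)` with `γ ∈ N` and `|n| < η + |γ|`. -/
abbrev MPlus := {p : S.M // S.deg p.2 < S.η + S.hom p.1}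

/-- The algebra `T⁺` of polynomials in the variables `Z_(γ,n)` and `Zᵢ`. -/
abbrev TPlus := MvPolynomial (S.MPlus ⊕ Fin d) ℝ

/-- The monomial `Z^(J,m)`. -/
def ZMon (J : MI S.MPlus) (m : Fin d → ℕ) : S.TPlus :=
  (J.prod fun p j => MvPolynomial.X (Sum.inl p) ^ j) * ∏ i, MvPolynomial.X (Sum.inr i) ^ m i

/-- The coefficients of the action for `J` supported in `MPlus`. -/
def actCoeffPlus (J : MI S.MPlus) (m : Fin d → ℕ) (β γ : MI (Coord d Λ)) : ℝ :=
  S.actCoeff (J.mapDomain Subtype.val) m β γ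

/-- All multi-indices under consideration: `P ⊔ N` together with `N₋`. -/
abbrev All : Set (MI (Coord d Λ)) := S.Pop ∪ S.NMin

/-- The vector space with basis `z_β`, `β ∈ P ⊔ N ∪ N₋`. -/
abbrev TAll := S.All →₀ ℝ

/-- The model space with basis `z_β`, `β ∈ P ⊔ N`. -/
abbrev TPop := S.Pop →₀ ℝ

/-- The coaction `Δ⁺ z_β = ∑_{(J,m),γ} (D_(J,m))_β^γ Z^(J,m) ⊗ z_γ`. -/
def coaction : S.TAll →ₗ[ℝ] S.TPlus ⊗[ℝ] S.TAll :=
  Finsupp.linearCombination ℝ fun β : S.All =>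
    ∑ᶠ q : (MI S.MPlus × (Fin d → ℕ)) × S.All,
      S.actCoeffPlus q.1.1 q.1.2 β q.2 • (S.ZMon q.1.1 q.1.2 ⊗ₜ[ℝ] Finsupp.single q.2 (1 : ℝ))

/-- The inclusion of `P ⊔ N`. -/
def popIncl : S.Pop → S.All := fun β => ⟨β.1, Or.inl β.2⟩

/-- The projection onto the span of the `z_β` with `β ∈ P ⊔ N`. -/
def projPop : S.TAll →ₗ[ℝ] S.TPop :=
  Finsupp.lcomapDomain S.popIncl fun _ _ h => Subtype.ext (congrArg (fun x : S.All => x.1) h)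

/-- The projected coaction, restricted to `TPop`. -/
def projCoaction : S.TPop →ₗ[ℝ] S.TPlus ⊗[ℝ] S.TPop :=
  S.projPop.lTensor S.TPlus ∘ₗ S.coaction ∘ₗ Finsupp.lmapDomain ℝ ℝ S.popIncl

/-- `Γ⁺_π = (π ⊗ id) Δ⁺` (projected) for a character `π` of `T⁺`. -/
def Gam (π : S.TPlus →ₐ[ℝ] ℝ) : Module.End ℝ S.TPop :=
  (TensorProduct.lid ℝ S.TPop).toLinearMap ∘ₗ π.toLinearMap.rTensor S.TPop ∘ₗ S.projCoaction

/-- The set `G` of all `Γ⁺_π`. -/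
def G : Set (Module.End ℝ S.TPop) := Set.range S.Gam

/-- The set of homogeneities
`A = {|β| : β ∈ N₋} ∪ {|β| + η : β ∈ P ⊔ N}`. -/
def A : Set ℝ := S.hom '' S.NMin ∪ (fun β => S.hom β + S.η) '' S.Pop

/-- The homogeneous part of degree `ν` of the model space, `z_β` having degree `|β| + η`. -/
def graded (ν : S.A) : Submodule ℝ S.TPop :=
  Finsupp.supported ℝ ℝ {β : S.Pop | S.hom β + S.η = ν}

end Setting

/-- Regularity structures `(A, T, G)`: the set `A` of homogeneities is bounded from below and
locally finite, the model space `V` is the direct sum of the `T ν`, `ν ∈ A`, and `G` is a group of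
linear endomorphisms of `V` with `Γ a - a ∈ ⨁_{ν' < ν} T ν'` for all `Γ ∈ G` and `a ∈ T ν`. -/
structure IsRegularityStructure {V : Type*} [AddCommGroup V] [Module ℝ V] (A : Set ℝ)
    (T : A → Submodule ℝ V) (G : Set (Module.End ℝ V)) : Prop where
  bddBelow : BddBelow A
  locallyFinite : ∀ a b : ℝ, (A ∩ Set.Icc a b).Finite
  isInternal : DirectSum.IsInternal T
  isGroup : ∃ H : Subgroup (Module.End ℝ V)ˣ, G = Units.val '' (H : Set (Module.End ℝ V)ˣ)
  triangular : ∀ Γ ∈ G, ∀ ν : A, ∀ a ∈ T ν, Γ a - a ∈ ⨆ ν' : A, ⨆ _ : ν' < ν, T ν'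

end MultiIndexRS

end

/-!
A character `π` of `T⁺` defines a translation, that is, an algebra morphism from polynomials to
power series: it sends `z_n` to the shift of the `n`-th monomial by `(π Zᵢ)ᵢ` plus
`∑_γ π(Z_(γ,n)) z^γ`, and it sends the Taylor coefficients `z_(l,k)` of a nonlinearity to its Taylor
coefficients at the shifted point. The map `Γ⁺_π` is the transpose of this translation. Indeed, the
universal translation `C`, with coefficients in `T⁺`, satisfies `∂C/∂Z_(γ,n) = z^γ C ∘ D^(n)` and,
where all `Z_(γ,n)` vanish, `∂C/∂Zᵢ = C ∘ ∂ᵢ`, so the coefficient of `Z^(J,m)` in `C` is the action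
of `D_(J,m)`.

Each generator of `T⁺` has positive degree, by which the corresponding generator of `L` raises the
homogeneity; this gives triangularity. Compositions of translations are substitutions of power
series into power series, and they are again translations. The inverse is found by solving a
unitriangular system along the homogeneity, which is well-founded on `N` because subcriticality
leaves only finitely many multi-indices below any given homogeneity.
-/

noncomputable section

namespace MultiIndexRS

/-! ### Derivations -/

section CoefficientwiseDerivation

variable {σ R A : Type*} [CommRing R] [CommRing A] [Algebra R A]

/-- The derivation of the power series ring over `A` which applies a derivation of `A` to the
coefficients. -/
def mapDeriv (δ : Derivation R A A) : Derivation R (MvPowerSeries σ A) (MvPowerSeries σ A) :=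
  Derivation.mk' (LinearMap.pi fun β => δ.toLinearMap ∘ₗ
    (MvPowerSeries.coeff β).restrictScalars R) fun f g => by
      classical
      ext β
      change δ (MvPowerSeries.coeff β (f * g)) = _
      simp only [smul_eq_mul, mul_comm g, map_add, MvPowerSeries.coeff_mul, map_sum,
        Derivation.leibniz, ← Finset.sum_add_distrib]
      refine Finset.sum_congr rfl fun x _ => ?_
      rw [mul_comm (MvPowerSeries.coeff x.2 g)]
      rfl

theorem coeff_mapDeriv (δ : Derivation R A A) (f : MvPowerSeries σ A) (β : σ →₀ ℕ) :
    MvPowerSeries.coeff β (mapDeriv δ f) = δ (MvPowerSeries.coeff β f) := rfl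

theorem mapDeriv_C (δ : Derivation R A A) (a : A) :
    mapDeriv δ (MvPowerSeries.C a : MvPowerSeries σ A) = MvPowerSeries.C (δ a) := by
  classical
  ext β
  rw [coeff_mapDeriv, MvPowerSeries.coeff_C, MvPowerSeries.coeff_C]
  split_ifs <;> simp

theorem mapDeriv_X (δ : Derivation R A A) (s : σ) :
    mapDeriv δ (MvPowerSeries.X s : MvPowerSeries σ A) = 0 := by
  classical
  ext β
  rw [coeff_mapDeriv, MvPowerSeries.coeff_X]
  split_ifs <;> simp

theorem derivation_algHom_apply (C : MvPolynomial σ R →ₐ[R] A) (δ : Derivation R A A) (u : A)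
    (E : Derivation R (MvPolynomial σ R) (MvPolynomial σ R))
    (h : ∀ x, δ (C (MvPolynomial.X x)) = u * C (E (MvPolynomial.X x))) (f : MvPolynomial σ R) :
    δ (C f) = u * C (E f) := by
  induction f using MvPolynomial.induction_on with
  | C a => simp [← MvPolynomial.algebraMap_eq]
  | add p q hp hq => simp only [map_add, mul_add, hp, hq]
  | mul_X p x hp =>
    simp only [map_mul, Derivation.leibniz, hp, h, map_add, smul_eq_mul]
    ring

end CoefficientwiseDerivation

/-! ### Taylor expansion of monomials -/

section Taylor

variable {ι A : Type*} [CommRing A]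

/-- The translation `X n ↦ X n + p n` of polynomials. -/
def shift (p : ι → A) : MvPolynomial ι A →ₐ[A] MvPolynomial ι A :=
  MvPolynomial.aeval fun n => MvPolynomial.X n + MvPolynomial.C (p n)

/-- The Taylor coefficient `∏ n, (k' n choose k n) * p n ^ (k' n - k n)`, that is, the coefficient
of `X ^ k` in `(X + p) ^ k'`. -/
def taylorCoeff (p : ι → A) (k' k : ι →₀ ℕ) : A :=
  (shift p (MvPolynomial.monomial k' 1)).coeff k

theorem shift_monomial (p : ι → A) (k : ι →₀ ℕ) : shift p (MvPolynomial.monomial k 1) =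
    k.prod fun n j => (MvPolynomial.X n + MvPolynomial.C (p n)) ^ j := by
  rw [shift, MvPolynomial.aeval_monomial, map_one, one_mul]

theorem shift_zero : shift (0 : ι → A) = AlgHom.id A _ := by
  ext n : 1
  simp [shift]

theorem shift_add (x y : ι → A) : shift (x + y) = (shift x).comp (shift y) := by
  ext n : 1
  simp [shift, add_assoc]

theorem taylorCoeff_zero [DecidableEq ι] (k' k : ι →₀ ℕ) :
    taylorCoeff (0 : ι → A) k' k = if k' = k then 1 else 0 := by
  rw [taylorCoeff, shift_zero, AlgHom.id_apply, MvPolynomial.coeff_monomial]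

theorem coeff_shift (p : ι → A) (f : MvPolynomial ι A) (k : ι →₀ ℕ) :
    (shift p f).coeff k = ∑ j ∈ f.support, f.coeff j * taylorCoeff p j k := by
  conv_lhs => rw [MvPolynomial.as_sum f, map_sum, MvPolynomial.coeff_sum]
  refine Finset.sum_congr rfl fun j _ => ?_
  rw [← mul_one (f.coeff j), ← MvPolynomial.C_mul_monomial, ← MvPolynomial.algebraMap_eq,
    ← Algebra.smul_def, map_smul, MvPolynomial.coeff_smul, smul_eq_mul, mul_one, taylorCoeff]

theorem map_taylorCoeff {A' : Type*} [CommRing A'] (g : A →+* A') (p : ι → A) (k' k : ι →₀ ℕ) :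
    g (taylorCoeff p k' k) = taylorCoeff (fun n => g (p n)) k' k := by
  rw [taylorCoeff, ← MvPolynomial.coeff_map, taylorCoeff, shift_monomial, shift_monomial]
  simp [Finsupp.prod, map_prod]

theorem degreeOf_X_add_C_le [DecidableEq ι] (n m : ι) (a : A) :
    (MvPolynomial.X m + MvPolynomial.C a).degreeOf n ≤ if n = m then 1 else 0 := by
  refine (MvPolynomial.degreeOf_add_le _ _ _).trans ?_
  rw [MvPolynomial.degreeOf_C, Nat.max_zero]
  cases subsingleton_or_nontrivial A
  · simp [Subsingleton.elim (MvPolynomial.X m : MvPolynomial ι A) 0]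
  · rw [MvPolynomial.degreeOf_X]

theorem degreeOf_shift_monomial_le (p : ι → A) (k : ι →₀ ℕ) (n : ι) :
    (shift p (MvPolynomial.monomial k 1)).degreeOf n ≤ k n := by
  classical
  have hfactor (m : ι) :
      ((MvPolynomial.X m + MvPolynomial.C (p m)) ^ k m).degreeOf n ≤ if n = m then k m else 0 := by
    refine (MvPolynomial.degreeOf_pow_le n _ _).trans
      ((Nat.mul_le_mul_left _ (degreeOf_X_add_C_le n m _)).trans_eq ?_)
    rw [mul_ite, mul_one, mul_zero]
  rw [shift_monomial]
  refine (MvPolynomial.degreeOf_prod_le n _ _).trans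
    ((Finset.sum_le_sum fun m _ => hfactor m).trans ?_)
  rw [Finset.sum_ite_eq]
  split_ifs <;> omega

theorem taylorCoeff_eq_zero (p : ι → A) {k' k : ι →₀ ℕ} (h : ¬ k ≤ k') :
    taylorCoeff p k' k = 0 := by
  contrapose! h
  exact fun n => (MvPolynomial.monomial_le_degreeOf n (MvPolynomial.mem_support_iff.2 h)).trans
    (degreeOf_shift_monomial_le p k' n)

theorem taylorCoeff_add (x y : ι → A) {k' : ι →₀ ℕ} {F : Finset (ι →₀ ℕ)}
    (hF : ∀ j ≤ k', j ∈ F) (k : ι →₀ ℕ) :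
    taylorCoeff (x + y) k' k = ∑ j ∈ F, taylorCoeff y k' j * taylorCoeff x j k := by
  rw [taylorCoeff, shift_add, AlgHom.comp_apply, coeff_shift]
  refine Finset.sum_subset (fun j hj => hF j ?_) fun j _ hj => ?_
  · by_contra hle
    exact MvPolynomial.mem_support_iff.1 hj (taylorCoeff_eq_zero y hle)
  · rw [MvPolynomial.notMem_support_iff.1 hj, zero_mul]

/-- Chain rule: both sides come from derivations of the power series ring which agree on the
factors `X n + p n` of the shifted monomial. -/
theorem derivation_taylorCoeff {R : Type*} [CommRing R] [Algebra R A] (δ : Derivation R A A)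
    (p : ι → A) {k' : ι →₀ ℕ} {F : Finset ι} (hF : ∀ n, k' n ≠ 0 → δ (p n) ≠ 0 → n ∈ F)
    (k : ι →₀ ℕ) : δ (taylorCoeff p k' k) =
      ∑ n ∈ F, δ (p n) * ((k n + 1) • taylorCoeff p k' (k + Finsupp.single n 1)) := by
  classical
  let E : Derivation R (MvPowerSeries ι A) (MvPowerSeries ι A) :=
    ∑ n ∈ F, (MvPowerSeries.C (δ (p n)) : MvPowerSeries ι A) •
      (MvPowerSeries.pderiv A n).restrictScalars R
  have hE (f : MvPowerSeries ι A) : E f =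
      ∑ n ∈ F, MvPowerSeries.C (δ (p n)) * MvPowerSeries.pderiv A n f := by
    rw [← Derivation.coeFnAddMonoidHom_apply, map_sum, Finset.sum_apply]
    rfl
  let factor (n : ι) : MvPowerSeries ι A := MvPowerSeries.X n + MvPowerSeries.C (p n)
  have heq : Set.EqOn (mapDeriv δ) E (factor '' k'.support) := by
    rintro - ⟨n, hn, rfl⟩
    simp only [factor, hE, map_add, mapDeriv_X, mapDeriv_C, MvPowerSeries.pderiv_X, zero_add,
      MvPowerSeries.pderiv_C, add_zero, Pi.single_apply, mul_ite, mul_one, mul_zero,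
      Finset.sum_ite_eq]
    split_ifs with hnF
    · rfl
    · rw [not_not.1 (mt (hF n (Finsupp.mem_support_iff.1 hn)) hnF), map_zero]
  have hmem : ((shift p (MvPolynomial.monomial k' 1) : MvPolynomial ι A) : MvPowerSeries ι A) ∈
      Algebra.adjoin R (factor '' k'.support) := by
    rw [shift_monomial, Finsupp.prod, ← MvPolynomial.coeToMvPowerSeries.ringHom_apply, map_prod]
    refine Subalgebra.prod_mem _ fun n hn => ?_
    have hfactor : factor n ∈ Algebra.adjoin R (factor '' k'.support) :=
      Algebra.subset_adjoin ⟨n, hn, rfl⟩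
    simpa [factor] using Subalgebra.pow_mem _ hfactor (k' n)
  have hcoeff := congrArg (MvPowerSeries.coeff k) (Derivation.eqOn_adjoin heq hmem)
  simp only [hE, map_sum, coeff_mapDeriv, MvPolynomial.coeff_coe, MvPowerSeries.coeff_C_mul,
    MvPowerSeries.coeff_pderiv] at hcoeff
  rw [taylorCoeff, hcoeff]
  refine Finset.sum_congr rfl fun n _ => ?_
  rw [nsmul_eq_mul, Nat.cast_succ, mul_comm (_ + 1 : A), taylorCoeff]

end Taylor

/-! ### Infinite linear combinations of variables -/

section VarSum

variable {σ τ κ A B : Type*} [CommRing A] [CommRing B]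

theorem coeff_mul_X_eq_zero (f : MvPowerSeries σ A) {s : σ} {β : σ →₀ ℕ} (h : β s = 0) :
    MvPowerSeries.coeff β (f * MvPowerSeries.X s) = 0 := by
  classical
  rw [MvPowerSeries.X, MvPowerSeries.coeff_mul_monomial, if_neg]
  rw [Finsupp.single_le_iff, h]
  omega

theorem finite_support_coeff_mul_X (e : κ ↪ σ) (c : κ → MvPowerSeries σ A) (β : σ →₀ ℕ) :
    (Function.support fun k => MvPowerSeries.coeff β (c k * MvPowerSeries.X (e k))).Finite :=
  (β.support.finite_toSet.preimage e.injective.injOn).subset fun _ hk =>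
    Finsupp.mem_support_iff.2 fun h => hk (coeff_mul_X_eq_zero _ h)

/-- The power series `∑ k, c k * X (e k)`, which makes sense for infinitely many `k` since the
variables `X (e k)` are distinct. -/
def varSum (e : κ ↪ σ) :
    (κ → MvPowerSeries σ A) →ₗ[MvPowerSeries σ A] MvPowerSeries σ A where
  toFun c := fun β => ∑ᶠ k, MvPowerSeries.coeff β (c k * MvPowerSeries.X (e k))
  map_add' c c' := by
    ext β
    change ∑ᶠ k, MvPowerSeries.coeff β ((c k + c' k) * MvPowerSeries.X (e k)) = _
    simp only [add_mul, map_add]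
    exact finsum_add_distrib (finite_support_coeff_mul_X e c β) (finite_support_coeff_mul_X e c' β)
  map_smul' f c := by
    classical
    ext β
    let s : MvPowerSeries σ A := fun β => ∑ᶠ k, MvPowerSeries.coeff β (c k * MvPowerSeries.X (e k))
    change ∑ᶠ k, MvPowerSeries.coeff β (f * c k * MvPowerSeries.X (e k)) =
      MvPowerSeries.coeff β (f * s)
    have hs (γ : σ →₀ ℕ) : MvPowerSeries.coeff γ s =
      ∑ᶠ k, MvPowerSeries.coeff γ (c k * MvPowerSeries.X (e k)) := rfl
    have hfin (x : (σ →₀ ℕ) × (σ →₀ ℕ)) : (Function.support fun k => MvPowerSeries.coeff x.1 f *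
        MvPowerSeries.coeff x.2 (c k * MvPowerSeries.X (e k))).Finite :=
      (finite_support_coeff_mul_X e c x.2).subset fun k hk => right_ne_zero_of_mul hk
    simp only [mul_assoc, MvPowerSeries.coeff_mul _ f]
    rw [finsum_sum_comm _ _ fun x _ => hfin x]
    exact Finset.sum_congr rfl fun x _ =>
      (hs x.2 ▸ mul_finsum' _ _ (finite_support_coeff_mul_X e c x.2)).symm

theorem coeff_varSum (e : κ ↪ σ) (c : κ → MvPowerSeries σ A) (β : σ →₀ ℕ) :
    MvPowerSeries.coeff β (varSum e c) =
      ∑ᶠ k, MvPowerSeries.coeff β (c k * MvPowerSeries.X (e k)) := rfl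

theorem coeff_varSum_congr (e : κ ↪ σ) {c c' : κ → MvPowerSeries σ A} {β : σ →₀ ℕ}
    (h : ∀ k, β (e k) ≠ 0 → c k = c' k) :
    MvPowerSeries.coeff β (varSum e c) = MvPowerSeries.coeff β (varSum e c') := by
  refine finsum_congr fun k => ?_
  by_cases hβ : β (e k) = 0
  · rw [coeff_mul_X_eq_zero _ hβ, coeff_mul_X_eq_zero _ hβ]
  · rw [h k hβ]

theorem varSum_eq_sum (e : κ ↪ σ) {c : κ → MvPowerSeries σ A} {F : Finset κ}
    (hF : ∀ k ∉ F, c k = 0) : varSum e c = ∑ k ∈ F, c k * MvPowerSeries.X (e k) := by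
  ext β
  rw [coeff_varSum, map_sum]
  refine finsum_eq_sum_of_support_subset _ fun k hk => ?_
  by_contra h
  refine hk ?_
  change MvPowerSeries.coeff β (c k * MvPowerSeries.X (e k)) = 0
  rw [hF k h, zero_mul, map_zero]

open Classical in
theorem varSum_eq_sum_add (e : κ ↪ σ) (c : κ → MvPowerSeries σ A) (F : Finset κ) :
    varSum e c = ∑ k ∈ F, c k * MvPowerSeries.X (e k) +
      varSum e fun k => if k ∈ F then 0 else c k := by
  have hsplit : c = (fun k => if k ∈ F then c k else 0) + fun k => if k ∈ F then 0 else c k := by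
    ext1 k
    rw [Pi.add_apply]
    split_ifs <;> simp
  conv_lhs => rw [hsplit]
  rw [map_add, varSum_eq_sum e fun k hk => if_neg hk]
  congr 1
  exact Finset.sum_congr rfl fun k hk => by rw [if_pos hk]

theorem mapDeriv_varSum {R : Type*} [CommRing R] [Algebra R A] (e : κ ↪ σ)
    (δ : Derivation R A A) (c : κ → MvPowerSeries σ A) :
    mapDeriv δ (varSum e c) = varSum e fun k => mapDeriv δ (c k) := by
  ext β
  rw [coeff_mapDeriv, coeff_varSum, coeff_varSum]
  refine (AddMonoidHom.map_finsum (δ : A →+ A) (finite_support_coeff_mul_X e c β)).trans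
    (finsum_congr fun k => ?_)
  change δ (MvPowerSeries.coeff β (c k * MvPowerSeries.X (e k))) = _
  rw [← coeff_mapDeriv, Derivation.leibniz, mapDeriv_X, smul_zero, zero_add, smul_eq_mul, mul_comm]

theorem map_varSum (e : κ ↪ σ) (g : A →+* B) (c : κ → MvPowerSeries σ A) :
    MvPowerSeries.map g (varSum e c) = varSum e fun k => MvPowerSeries.map g (c k) := by
  ext β
  rw [MvPowerSeries.coeff_map, coeff_varSum, coeff_varSum]
  refine (AddMonoidHom.map_finsum (g : A →+ B) (finite_support_coeff_mul_X e c β)).trans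
    (finsum_congr fun k => ?_)
  change g (MvPowerSeries.coeff β (c k * MvPowerSeries.X (e k))) = _
  rw [← MvPowerSeries.coeff_map, map_mul, MvPowerSeries.map_X]

theorem coeff_eq_zero_of_dvd {f g : MvPowerSeries σ A} (h : f ∣ g) {β : σ →₀ ℕ}
    (hf : ∀ β' ≤ β, MvPowerSeries.coeff β' f = 0) : MvPowerSeries.coeff β g = 0 := by
  classical
  obtain ⟨q, rfl⟩ := h
  rw [MvPowerSeries.coeff_mul]
  refine Finset.sum_eq_zero fun x hx => ?_
  rw [hf x.1 (Finset.HasAntidiagonal.mem_antidiagonal.1 hx ▸ le_self_add), zero_mul]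

variable [Algebra A B] {a : σ → MvPowerSeries τ B}

theorem coeff_subst_varSum_eq_zero (ha : MvPowerSeries.HasSubst a) (e : κ ↪ σ)
    {c : κ → MvPowerSeries σ A} {β : τ →₀ ℕ}
    (h : ∀ k, c k ≠ 0 → ∀ β' ≤ β, MvPowerSeries.coeff β' (a (e k)) = 0) :
    MvPowerSeries.coeff β (MvPowerSeries.subst a (varSum e c)) = 0 := by
  rw [MvPowerSeries.coeff_subst ha]
  refine finsum_eq_zero_of_forall_eq_zero fun γ => ?_
  by_cases hγ : ∃ k, c k ≠ 0 ∧ γ (e k) ≠ 0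
  · obtain ⟨k, hk, hγk⟩ := hγ
    have hdvd : a (e k) ∣ γ.prod fun s j => a s ^ j := (dvd_pow_self _ hγk).trans
      (Finset.dvd_prod_of_mem _ (Finsupp.mem_support_iff.2 hγk))
    rw [coeff_eq_zero_of_dvd hdvd (h k hk), smul_zero]
  · rw [coeff_varSum, finsum_eq_zero_of_forall_eq_zero, zero_smul]
    intro k
    by_cases hk : c k = 0
    · rw [hk, zero_mul, map_zero]
    · exact coeff_mul_X_eq_zero _ (not_not.1 fun hγk => hγ ⟨k, hk, hγk⟩)

theorem exists_coeff_subst_varSum (ha : MvPowerSeries.HasSubst a) (e : κ ↪ σ) (β : τ →₀ ℕ) :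
    ∃ F₀ : Finset κ, ∀ F, F₀ ⊆ F → ∀ c : κ → MvPowerSeries σ A,
      MvPowerSeries.coeff β (MvPowerSeries.subst a (varSum e c)) =
        ∑ k ∈ F, MvPowerSeries.coeff β (MvPowerSeries.subst a (c k) * a (e k)) := by
  classical
  have hfin : (⋃ β' ∈ Set.Iic β, {k | MvPowerSeries.coeff β' (a (e k)) ≠ 0}).Finite :=
    (Set.finite_Iic β).biUnion fun β' _ => (ha.coeff_zero β').preimage e.injective.injOn
  refine ⟨hfin.toFinset, fun F hF c => ?_⟩
  have htail : MvPowerSeries.coeff β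
      (MvPowerSeries.subst a (varSum e fun k => if k ∈ F then 0 else c k)) = 0 := by
    refine coeff_subst_varSum_eq_zero ha e fun k hk β' hβ' => ?_
    by_contra hne
    exact hk (if_pos (hF (hfin.mem_toFinset.2 (Set.mem_biUnion hβ' hne))))
  rw [varSum_eq_sum_add e c F, MvPowerSeries.subst_add ha, map_add, htail, add_zero]
  simp only [← MvPowerSeries.substAlgHom_apply ha, map_sum, map_mul, MvPowerSeries.substAlgHom_X]

end VarSum

/-! ### Universal enveloping algebras -/

theorem envelopingAlgebra_induction {R L : Type*} [CommRing R] [LieRing L] [LieAlgebra R L]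
    {P : UniversalEnvelopingAlgebra R L → Prop}
    (one : P 1) (smul : ∀ (c : R) U, P U → P (c • U)) (add : ∀ U V, P U → P V → P (U + V))
    (mul : ∀ (E : L) U, P U → P (UniversalEnvelopingAlgebra.ι R E * U))
    (U : UniversalEnvelopingAlgebra R L) : P U := by
  let A : Subalgebra R (UniversalEnvelopingAlgebra R L) :=
    { carrier := {U | ∀ V, P V → P (U * V)}
      mul_mem' := fun {a b} ha hb V hV => by rw [mul_assoc]; exact ha _ (hb _ hV)
      add_mem' := fun {a b} ha hb V hV => by rw [add_mul]; exact add _ _ (ha _ hV) (hb _ hV)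
      algebraMap_mem' := fun c V hV => by rw [← Algebra.smul_def]; exact smul _ _ hV }
  let g : UniversalEnvelopingAlgebra R L →ₐ[R] A := UniversalEnvelopingAlgebra.lift R
    { toFun := fun E => ⟨UniversalEnvelopingAlgebra.ι R E, fun V hV => mul E V hV⟩
      map_add' := fun E F => Subtype.ext (by simp)
      map_smul' := fun c E => Subtype.ext (by simp)
      map_lie' := fun {E F} => Subtype.ext (by
        simp [LieRing.of_associative_ring_bracket]) }
  have hg : A.val.comp g = AlgHom.id R _ := by
    apply UniversalEnvelopingAlgebra.hom_ext
    ext E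
    simp [g]
  have hU : U ∈ A := by
    have hgU := DFunLike.congr_fun hg U
    rw [AlgHom.id_apply] at hgU
    exact hgU ▸ (g U).2
  simpa using hU 1 one

variable {d : ℕ} {Λ : Type*}

namespace Setting

variable (S : Setting d Λ)

/-! ### Degrees and subcriticality -/

theorem s_pos (i : Fin d) : 0 < S.s i := zero_lt_one.trans_le (S.one_le_s i)

theorem deg_nonneg (n : Fin d → ℕ) : 0 ≤ S.deg n :=
  Finset.sum_nonneg fun i _ => mul_nonneg (S.s_pos i).le (Nat.cast_nonneg _)

theorem le_deg (n : Fin d → ℕ) (i : Fin d) : (n i : ℝ) ≤ S.deg n :=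
  (le_mul_of_one_le_left (Nat.cast_nonneg _) (S.one_le_s i)).trans <|
    Finset.single_le_sum (f := fun i => S.s i * (n i : ℝ))
      (fun j _ => mul_nonneg (S.s_pos j).le (Nat.cast_nonneg _)) (Finset.mem_univ i)

theorem deg_mono {n n' : Fin d → ℕ} (h : n ≤ n') : S.deg n ≤ S.deg n' :=
  Finset.sum_le_sum fun i _ => mul_le_mul_of_nonneg_left (Nat.cast_le.2 (h i)) (S.s_pos i).le

theorem deg_add_single (n : Fin d → ℕ) (i : Fin d) :
    S.deg (n + Pi.single i 1) = S.deg n + S.s i := by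
  simp [deg, mul_add, Finset.sum_add_distrib, Pi.single_apply]

theorem finite_deg_le (c : ℝ) : {n : Fin d → ℕ | S.deg n ≤ c}.Finite :=
  (Set.Finite.pi' fun _ : Fin d => Set.finite_Iic ⌊c⌋₊).subset fun n hn i =>
    Nat.le_floor ((S.le_deg n i).trans hn)

variable {S}

theorem Subcritical.mono {l : Option Λ} {k k' : MI (Fin d → ℕ)} (h : S.Subcritical l k')
    (hk : k ≤ k') : S.Subcritical l k :=
  ⟨h.1, fun j hj hjk => h.2 j hj (hjk.trans hk)⟩

theorem Subcritical.deg_lt {l : Option Λ} {k : MI (Fin d → ℕ)} (h : S.Subcritical l k)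
    {n : Fin d → ℕ} (hn : k n ≠ 0) : S.deg n < S.η := by
  have hsub := (h.2 (Finsupp.single n 1) (by simp)
    (Finsupp.single_le_iff.2 (Nat.one_le_iff_ne_zero.2 hn))).1
  rw [Finsupp.sum_single_index (by simp), Nat.cast_one, mul_one] at hsub
  linarith

variable (S)

theorem D_X_inr [DecidableEq (Fin d → ℕ)] (n m : Fin d → ℕ) :
    S.D n (MvPolynomial.X (Sum.inr m)) = if m = n then 1 else 0 := by
  rw [D, MvPolynomial.mkDerivation_X, Sum.elim_inr]
  congr

open Classical in
theorem D_X_inl (n : Fin d → ℕ) (l : Option Λ) (k : MI (Fin d → ℕ)) :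
    S.D n (MvPolynomial.X (Sum.inl (l, k))) =
      if S.Subcritical l (k + Finsupp.single n 1) then
        (k n + 1) • MvPolynomial.X (Sum.inl (l, k + Finsupp.single n 1)) else 0 := by
  rw [D, MvPolynomial.mkDerivation_X, Sum.elim_inl, ← Nat.cast_smul_eq_nsmul ℝ, Nat.cast_succ]

theorem dx_X_inr (i : Fin d) (m : Fin d → ℕ) :
    S.dx i (MvPolynomial.X (Sum.inr m)) =
      (m i + 1) • MvPolynomial.X (Sum.inr (m + Pi.single i 1)) := by
  classical
  rw [dx, MvPolynomial.mkDerivation_X, finsum_eq_single _ m]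
  · rw [D_X_inr, if_pos rfl, mul_one, ← Nat.cast_smul_eq_nsmul ℝ, Nat.cast_succ]
  · intro n hn
    rw [D_X_inr, if_neg hn.symm, mul_zero, smul_zero]

theorem dx_X_inl (i : Fin d) (l : Option Λ) (k : MI (Fin d → ℕ)) {F : Finset (Fin d → ℕ)}
    (hF : ∀ n, S.deg n < S.η → n ∈ F) :
    S.dx i (MvPolynomial.X (Sum.inl (l, k))) = ∑ n ∈ F,
      (n i + 1) • (MvPolynomial.X (Sum.inr (n + Pi.single i 1)) *
        S.D n (MvPolynomial.X (Sum.inl (l, k)))) := by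
  classical
  simp only [dx, MvPolynomial.mkDerivation_X, ← Nat.cast_smul_eq_nsmul ℝ, Nat.cast_succ]
  refine finsum_eq_sum_of_support_subset _ fun n hn => hF n ?_
  by_contra h
  refine hn ?_
  dsimp only
  rw [D_X_inl, if_neg, mul_zero, smul_zero]
  exact fun hs => h (hs.deg_lt (n := n) (by simp))

/-! ### Translations -/

section Translation

variable {K : Type*} [CommRing K] (y : (Fin d → ℕ) → MvPowerSeries (Coord d Λ) K)

variable (d) in
/-- The coordinates `z_(l,k)` with fixed `l`. -/
def inlEmb (l : Option Λ) : MI (Fin d → ℕ) ↪ Coord d Λ :=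
  ⟨fun k => Sum.inl (l, k), fun _ _ h => (Prod.ext_iff.1 (Sum.inl_injective h)).2⟩

theorem inlEmb_apply (l : Option Λ) (k : MI (Fin d → ℕ)) : inlEmb d l k = Sum.inl (l, k) := rfl

open Classical in
/-- The coefficients of the variables `z_(l,k')` in the image of `z_(l,k)` under the translation
`z_n ↦ y n`. If `z_(l,k)` stands for the `k`-th Taylor coefficient of a nonlinearity, then the
translation passes to the Taylor coefficients at the point shifted by `y n - z_n`. -/
def taylorRow (l : Option Λ) (k : MI (Fin d → ℕ)) :
    MI (Fin d → ℕ) → MvPowerSeries (Coord d Λ) K := fun k' =>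
  if S.Subcritical l k' then taylorCoeff (fun n => y n - MvPowerSeries.X (Sum.inr n)) k' k else 0

open Classical in
/-- The images of the coordinates under the translation `z_n ↦ y n`. -/
def translVar : Coord d Λ → MvPowerSeries (Coord d Λ) K :=
  Sum.elim
    (fun lk => if S.Subcritical lk.1 lk.2 then varSum (inlEmb d lk.1) (S.taylorRow y lk.1 lk.2)
      else MvPowerSeries.X (Sum.inl lk))
    y

/-- The translation `z_n ↦ y n`: the algebra morphism which shifts the nonlinearities
accordingly. -/
def transl [Algebra ℝ K] : Poly d Λ →ₐ[ℝ] MvPowerSeries (Coord d Λ) K :=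
  MvPolynomial.aeval (S.translVar y)

variable {l : Option Λ} {k : MI (Fin d → ℕ)}

theorem taylorRow_eq_zero {k' : MI (Fin d → ℕ)} (h : ¬ k ≤ k') : S.taylorRow y l k k' = 0 := by
  rw [taylorRow, taylorCoeff_eq_zero _ h, ite_self]

theorem taylorRow_of_not_subcritical (h : ¬ S.Subcritical l k) : S.taylorRow y l k = 0 := by
  ext1 k'
  rw [taylorRow]
  split_ifs with hk'
  · exact taylorCoeff_eq_zero _ fun hk => h (hk'.mono hk)
  · rfl

theorem mapDeriv_taylorRow {R : Type*} [CommRing R] [Algebra R K] (δ : Derivation R K K)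
    {F : Finset (Fin d → ℕ)} (hF : ∀ n, S.deg n < S.η → mapDeriv δ (y n) ≠ 0 → n ∈ F)
    (l : Option Λ) (k k' : MI (Fin d → ℕ)) : mapDeriv δ (S.taylorRow y l k k') =
      ∑ n ∈ F, mapDeriv δ (y n) * ((k n + 1) • S.taylorRow y l (k + Finsupp.single n 1) k') := by
  simp only [taylorRow]
  split_ifs with h
  · rw [derivation_taylorCoeff (mapDeriv δ) _ (F := F)]
    · simp only [map_sub, mapDeriv_X, sub_zero]
    · simpa only [map_sub, mapDeriv_X, sub_zero] using fun n hn => hF n (h.deg_lt hn)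
  · simp

theorem translVar_inl_of_subcritical (h : S.Subcritical l k) :
    S.translVar y (Sum.inl (l, k)) = varSum (inlEmb d l) (S.taylorRow y l k) := by
  rw [translVar, Sum.elim_inl, if_pos h]

theorem translVar_inl_of_not_subcritical (h : ¬ S.Subcritical l k) :
    S.translVar y (Sum.inl (l, k)) = MvPowerSeries.X (Sum.inl (l, k)) := by
  rw [translVar, Sum.elim_inl, if_neg h]

theorem translVar_inr (n : Fin d → ℕ) : S.translVar y (Sum.inr n) = y n := rfl

theorem transl_X [Algebra ℝ K] (x : Coord d Λ) :
    S.transl y (MvPolynomial.X x) = S.translVar y x := MvPolynomial.aeval_X _ _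

theorem transl_D_X_inl [Algebra ℝ K] (n : Fin d → ℕ) (l : Option Λ) (k : MI (Fin d → ℕ)) :
    S.transl y (S.D n (MvPolynomial.X (Sum.inl (l, k)))) =
      varSum (inlEmb d l) ((k n + 1) • S.taylorRow y l (k + Finsupp.single n 1)) := by
  classical
  rw [map_nsmul, D_X_inl]
  split_ifs with h
  · rw [map_nsmul, transl_X, translVar_inl_of_subcritical S y h]
  · rw [taylorRow_of_not_subcritical S y h, map_zero, map_zero, smul_zero]

theorem mapDeriv_translVar_inl [Algebra ℝ K] (δ : Derivation ℝ K K) {F : Finset (Fin d → ℕ)}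
    (hF : ∀ n, S.deg n < S.η → mapDeriv δ (y n) ≠ 0 → n ∈ F) (l : Option Λ)
    (k : MI (Fin d → ℕ)) :
    mapDeriv δ (S.translVar y (Sum.inl (l, k))) =
      ∑ n ∈ F, mapDeriv δ (y n) * S.transl y (S.D n (MvPolynomial.X (Sum.inl (l, k)))) := by
  classical
  by_cases h : S.Subcritical l k
  · simp only [translVar_inl_of_subcritical S y h, mapDeriv_varSum, transl_D_X_inl, ← smul_eq_mul,
      ← map_smul]
    rw [← map_sum]
    congr 1
    ext1 k'
    rw [mapDeriv_taylorRow S y δ hF, Finset.sum_apply]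
    rfl
  · rw [translVar_inl_of_not_subcritical S y h, mapDeriv_X]
    refine (Finset.sum_eq_zero fun n _ => ?_).symm
    rw [D_X_inl, if_neg fun h' => h (h'.mono le_self_add), map_zero, mul_zero]

theorem map_translVar {K' : Type*} [CommRing K'] (g : K →+* K') (x : Coord d Λ) :
    MvPowerSeries.map g (S.translVar y x) = S.translVar (fun n => MvPowerSeries.map g (y n)) x := by
  rcases x with ⟨l, k⟩ | n
  · by_cases h : S.Subcritical l k
    · rw [translVar_inl_of_subcritical S _ h, translVar_inl_of_subcritical S _ h, map_varSum]
      congr 1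
      ext1 k'
      rw [taylorRow, taylorRow, apply_ite (MvPowerSeries.map g), map_taylorCoeff, map_zero]
      simp only [map_sub, MvPowerSeries.map_X]
    · rw [translVar_inl_of_not_subcritical S _ h, translVar_inl_of_not_subcritical S _ h,
        MvPowerSeries.map_X]
  · rfl

theorem map_transl [Algebra ℝ K] {K' : Type*} [CommRing K'] [Algebra ℝ K'] (g : K →ₐ[ℝ] K')
    (f : Poly d Λ) : MvPowerSeries.map (g : K →+* K') (S.transl y f) =
      S.transl (fun n => MvPowerSeries.map (g : K →+* K') (y n)) f := by
  induction f using MvPolynomial.induction_on with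
  | C a => simp [← MvPolynomial.algebraMap_eq, MvPowerSeries.algebraMap_apply]
  | add p q hp hq => rw [map_add, map_add, map_add, hp, hq]
  | mul_X p x hp => rw [map_mul, map_mul, map_mul, hp, transl_X, transl_X, map_translVar]

theorem translVar_X :
    S.translVar (fun n => (MvPowerSeries.X (Sum.inr n) : MvPowerSeries (Coord d Λ) K)) =
      MvPowerSeries.X := by
  classical
  ext1 x
  rcases x with ⟨l, k⟩ | n
  · by_cases h : S.Subcritical l k
    · have hrow (k' : MI (Fin d → ℕ)) : S.taylorRow (fun n => (MvPowerSeries.X (Sum.inr n) :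
          MvPowerSeries (Coord d Λ) K)) l k k' = if k' = k then 1 else 0 := by
        have hzero : taylorCoeff (fun _ => (0 : MvPowerSeries (Coord d Λ) K)) k' k =
            if k' = k then 1 else 0 := taylorCoeff_zero k' k
        simp only [taylorRow, sub_self]
        grind
      rw [translVar_inl_of_subcritical S _ h, varSum_eq_sum (F := {k}) _ fun k' hk' => by
        rw [hrow, if_neg (by simpa using hk')]]
      rw [Finset.sum_singleton, hrow, if_pos rfl, one_mul, inlEmb_apply]
    · rw [translVar_inl_of_not_subcritical S _ h]
  · rfl

theorem coeff_transl_X [Algebra ℝ K] (f : Poly d Λ) (β : MI (Coord d Λ)) :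
    MvPowerSeries.coeff β (S.transl
      (fun n => (MvPowerSeries.X (Sum.inr n) : MvPowerSeries (Coord d Λ) K)) f) =
      algebraMap ℝ K (f.coeff β) := by
  have htransl : S.transl (fun n => (MvPowerSeries.X (Sum.inr n) :
      MvPowerSeries (Coord d Λ) K)) f = (MvPolynomial.map (algebraMap ℝ K) f :
        MvPolynomial (Coord d Λ) K) := by
    rw [transl, translVar_X]
    induction f using MvPolynomial.induction_on with
    | C a => simp [MvPowerSeries.algebraMap_apply]
    | add p q hp hq => rw [map_add, map_add, hp, hq, MvPolynomial.coe_add]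
    | mul_X p x hp => rw [map_mul, map_mul, hp, MvPolynomial.coe_mul]; simp
  rw [htransl, MvPolynomial.coeff_coe, MvPolynomial.coeff_map]

variable {y}

theorem exists_le_of_coeff_translVar_inl_ne_zero {β : MI (Coord d Λ)}
    (h : MvPowerSeries.coeff β (S.translVar y (Sum.inl (l, k))) ≠ 0) :
    ∃ k', k ≤ k' ∧ β (Sum.inl (l, k')) ≠ 0 := by
  classical
  by_cases hs : S.Subcritical l k
  · rw [translVar_inl_of_subcritical S y hs, coeff_varSum] at h
    obtain ⟨k', hk'⟩ := not_forall.1 (mt finsum_eq_zero_of_forall_eq_zero h)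
    refine ⟨k', ?_, fun hβ => hk' (coeff_mul_X_eq_zero _ hβ)⟩
    by_contra hle
    rw [taylorRow_eq_zero S y hle, zero_mul, map_zero] at hk'
    exact hk' rfl
  · rw [translVar_inl_of_not_subcritical S y hs, MvPowerSeries.coeff_X] at h
    have hβ : β = Finsupp.single (Sum.inl (l, k)) 1 := by_contra fun hne => h (if_neg hne)
    exact ⟨k, le_rfl, by simp [hβ]⟩

theorem hasSubst_translVar (h0 : ∀ n, MvPowerSeries.constantCoeff (y n) = 0)
    (hfin : ∀ β, {n | MvPowerSeries.coeff β (y n) ≠ 0}.Finite) :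
    MvPowerSeries.HasSubst (S.translVar y) := by
  refine ⟨fun x => ?_, fun β => ?_⟩
  · suffices MvPowerSeries.constantCoeff (S.translVar y x) = 0 by rw [this]; exact IsNilpotent.zero
    rcases x with ⟨l, k⟩ | n
    · by_contra h
      rw [← MvPowerSeries.coeff_zero_eq_constantCoeff_apply] at h
      obtain ⟨k', -, hk'⟩ := S.exists_le_of_coeff_translVar_inl_ne_zero h
      exact hk' rfl
    · exact h0 n
  · have hinl : (⋃ x ∈ (β.support : Set (Coord d Λ)), Sum.elim
        (fun lk : Option Λ × MI (Fin d → ℕ) => inlEmb d lk.1 '' Set.Iic lk.2)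
        (fun _ => ∅) x).Finite := by
      refine β.support.finite_toSet.biUnion fun x _ => ?_
      rcases x with ⟨l, k'⟩ | n
      · exact (Set.finite_Iic k').image _
      · exact Set.finite_empty
    refine (((hfin β).image Sum.inr).union hinl).subset ?_
    rintro (⟨l, k⟩ | n) hx
    · obtain ⟨k', hk, hβ⟩ := S.exists_le_of_coeff_translVar_inl_ne_zero hx
      exact Or.inr (Set.mem_biUnion (Finsupp.mem_support_iff.2 hβ) ⟨k, hk, rfl⟩)
    · exact Or.inl ⟨n, hx, rfl⟩

end Translation

end Setting

/-- Functions on `Fin d` as multi-indices. -/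
abbrev toMI (n : Fin d → ℕ) : MI (Fin d) := Finsupp.equivFunOnFinite.symm n

theorem toMI_add_single (n : Fin d → ℕ) (i : Fin d) :
    toMI (n + Pi.single i 1) = toMI n + Finsupp.single i 1 := by
  classical
  ext j
  simp [Pi.single_apply, Finsupp.single_apply, eq_comm]

theorem single_inr_injective :
    Function.Injective fun n : Fin d → ℕ => (Finsupp.single (Sum.inr n) 1 : MI (Coord d Λ)) :=
  (Finsupp.single_left_injective one_ne_zero).comp Sum.inr_injective

namespace Setting

variable (S : Setting d Λ)

theorem single_inr_notMem_N (n : Fin d → ℕ) :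
    (Finsupp.single (Sum.inr n) 1 : MI (Coord d Λ)) ∉ S.N :=
  fun h => h.2.ne' (noiseHom_inr n)

theorem notMem_P_of_mem_N {β : MI (Coord d Λ)} (hβ : β ∈ S.N) : β ∉ P d Λ := by
  rintro ⟨n, rfl⟩
  exact S.single_inr_notMem_N n hβ

/-! ### The images of the polynomial coordinates -/

section ShiftedCoord

variable {K : Type*} [CommRing K]

/-- The image of `z_n`, the `n`-th Taylor coefficient of a power series in `d` variables, under the
shift of these variables by `h`. -/
def polyCoord (Λ : Type*) (h : Fin d → K) (n : Fin d → ℕ) : MvPowerSeries (Coord d Λ) K :=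
  Function.extend (fun n' : Fin d → ℕ => (Finsupp.single (Sum.inr n') 1 : MI (Coord d Λ)))
    (fun n' => taylorCoeff h (toMI n') (toMI n)) 0

theorem coeff_polyCoord_single (h : Fin d → K) (n n' : Fin d → ℕ) :
    MvPowerSeries.coeff (Finsupp.single (Sum.inr n') 1) (polyCoord Λ h n) =
      taylorCoeff h (toMI n') (toMI n) := by
  change polyCoord Λ h n (Finsupp.single (Sum.inr n') 1) = _
  exact single_inr_injective.extend_apply _ _ _

theorem coeff_polyCoord_of_notMem_P (h : Fin d → K) (n : Fin d → ℕ) {β : MI (Coord d Λ)}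
    (hβ : β ∉ P d Λ) : MvPowerSeries.coeff β (polyCoord Λ h n) = 0 := by
  change polyCoord Λ h n β = 0
  exact Function.extend_apply' _ _ _ hβ

theorem mapDeriv_polyCoord {R : Type*} [CommRing R] [Algebra R K] (δ : Derivation R K K)
    (h : Fin d → K) (n : Fin d → ℕ) : mapDeriv δ (polyCoord Λ h n) =
      ∑ i, MvPowerSeries.C (δ (h i)) * ((n i + 1) • polyCoord Λ h (n + Pi.single i 1)) := by
  ext β
  rw [coeff_mapDeriv, map_sum]
  simp only [MvPowerSeries.coeff_C_mul, map_nsmul]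
  by_cases hP : β ∈ P d Λ
  · obtain ⟨n', rfl⟩ := hP
    simp only [coeff_polyCoord_single, toMI_add_single]
    exact derivation_taylorCoeff δ h (F := Finset.univ) (by simp) _
  · simp only [coeff_polyCoord_of_notMem_P _ _ hP, map_zero, smul_zero, mul_zero,
      Finset.sum_const_zero]

open Classical in
/-- The power series `∑ w(γ,n) z^γ` over all `γ` with `(γ,n) ∈ M⁺`. -/
def noisePart (w : S.MPlus → K) (n : Fin d → ℕ) : MvPowerSeries (Coord d Λ) K := fun β =>
  if h : ∃ _ : β ∈ S.N, S.deg n < S.η + S.hom β then w ⟨(⟨β, h.1⟩, n), h.2⟩ else 0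

theorem coeff_noisePart (w : S.MPlus → K) {n : Fin d → ℕ} {β : MI (Coord d Λ)} (hβ : β ∈ S.N)
    (h : S.deg n < S.η + S.hom β) :
    MvPowerSeries.coeff β (S.noisePart w n) = w ⟨(⟨β, hβ⟩, n), h⟩ :=
  dif_pos ⟨hβ, h⟩

theorem coeff_noisePart_of_not (w : S.MPlus → K) {n : Fin d → ℕ} {β : MI (Coord d Λ)}
    (h : ¬ (β ∈ S.N ∧ S.deg n < S.η + S.hom β)) :
    MvPowerSeries.coeff β (S.noisePart w n) = 0 :=
  dif_neg fun ⟨h1, h2⟩ => h ⟨h1, h2⟩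

theorem noisePart_zero (n : Fin d → ℕ) : S.noisePart (0 : S.MPlus → K) n = 0 := by
  ext β
  by_cases h : β ∈ S.N ∧ S.deg n < S.η + S.hom β
  · exact S.coeff_noisePart _ h.1 h.2
  · exact S.coeff_noisePart_of_not _ h

/-- The image of `z_n` under the translation with parameters `w`. -/
def shiftedCoord (w : S.MPlus ⊕ Fin d → K) (n : Fin d → ℕ) : MvPowerSeries (Coord d Λ) K :=
  polyCoord Λ (fun i => w (Sum.inr i)) n + S.noisePart (fun x => w (Sum.inl x)) n

theorem shiftedCoord_elim_zero (h : Fin d → K) :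
    S.shiftedCoord (Sum.elim 0 h) = polyCoord Λ h := by
  ext1 n
  exact (congrArg (polyCoord Λ h n + ·) (S.noisePart_zero n)).trans (add_zero _)

variable (w : S.MPlus ⊕ Fin d → K) {n : Fin d → ℕ} {β : MI (Coord d Λ)}

theorem coeff_shiftedCoord_single (n n' : Fin d → ℕ) :
    MvPowerSeries.coeff (Finsupp.single (Sum.inr n') 1) (S.shiftedCoord w n) =
      taylorCoeff (fun i => w (Sum.inr i)) (toMI n') (toMI n) := by
  rw [shiftedCoord, map_add, coeff_polyCoord_single,
    coeff_noisePart_of_not S _ fun h => S.single_inr_notMem_N _ h.1, add_zero]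

theorem coeff_shiftedCoord (hβ : β ∈ S.N) (h : S.deg n < S.η + S.hom β) :
    MvPowerSeries.coeff β (S.shiftedCoord w n) = w (Sum.inl ⟨(⟨β, hβ⟩, n), h⟩) := by
  rw [shiftedCoord, map_add, coeff_polyCoord_of_notMem_P _ _ (S.notMem_P_of_mem_N hβ), zero_add,
    coeff_noisePart]

theorem coeff_shiftedCoord_of_not (hβ : β ∉ P d Λ)
    (h : ¬ (β ∈ S.N ∧ S.deg n < S.η + S.hom β)) :
    MvPowerSeries.coeff β (S.shiftedCoord w n) = 0 := by
  rw [shiftedCoord, map_add, coeff_polyCoord_of_notMem_P _ _ hβ, zero_add,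
    coeff_noisePart_of_not S _ h]

variable {w} in
theorem eq_shiftedCoord {f : MvPowerSeries (Coord d Λ) K}
    (hpoly : ∀ n', MvPowerSeries.coeff (Finsupp.single (Sum.inr n') 1) f =
      taylorCoeff (fun i => w (Sum.inr i)) (toMI n') (toMI n))
    (hnoise : ∀ β (hβ : β ∈ S.N) (h : S.deg n < S.η + S.hom β),
      MvPowerSeries.coeff β f = w (Sum.inl ⟨(⟨β, hβ⟩, n), h⟩))
    (hzero : ∀ β, β ∉ P d Λ → ¬ (β ∈ S.N ∧ S.deg n < S.η + S.hom β) →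
      MvPowerSeries.coeff β f = 0) : f = S.shiftedCoord w n := by
  ext β
  by_cases hP : β ∈ P d Λ
  · obtain ⟨n', rfl⟩ := hP
    rw [hpoly, coeff_shiftedCoord_single]
  · by_cases h : β ∈ S.N ∧ S.deg n < S.η + S.hom β
    · rw [hnoise β h.1 h.2, coeff_shiftedCoord]
    · rw [hzero β hP h, coeff_shiftedCoord_of_not S _ hP h]

theorem map_shiftedCoord {K' : Type*} [CommRing K'] (g : K →+* K') (n : Fin d → ℕ) :
    MvPowerSeries.map g (S.shiftedCoord w n) = S.shiftedCoord (fun x => g (w x)) n := by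
  refine S.eq_shiftedCoord (fun n' => ?_) (fun β hβ h => ?_) fun β hβ h => ?_
  · rw [MvPowerSeries.coeff_map, coeff_shiftedCoord_single, map_taylorCoeff]
  · rw [MvPowerSeries.coeff_map, coeff_shiftedCoord S w hβ h]
  · rw [MvPowerSeries.coeff_map, coeff_shiftedCoord_of_not S _ hβ h, map_zero]

theorem shiftedCoord_zero :
    S.shiftedCoord (0 : S.MPlus ⊕ Fin d → K) = fun n => MvPowerSeries.X (Sum.inr n) := by
  classical
  ext1 n
  have hX {β : MI (Coord d Λ)} (hβ : β ∉ P d Λ) :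
      MvPowerSeries.coeff β (MvPowerSeries.X (Sum.inr n) : MvPowerSeries (Coord d Λ) K) = 0 := by
    rw [MvPowerSeries.coeff_X, if_neg]
    rintro rfl
    exact hβ ⟨n, rfl⟩
  refine (S.eq_shiftedCoord (fun n' => ?_) (fun β hβ _ => hX (S.notMem_P_of_mem_N hβ))
    fun β hβ _ => hX hβ).symm
  rw [MvPowerSeries.coeff_X]
  exact (if_congr (single_inr_injective.eq_iff.trans
    Finsupp.equivFunOnFinite.symm.injective.eq_iff.symm) rfl rfl).trans
    (taylorCoeff_zero (toMI n') (toMI n)).symm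

theorem hasSubst_translVar_shiftedCoord :
    MvPowerSeries.HasSubst (S.translVar (S.shiftedCoord w)) := by
  refine S.hasSubst_translVar (fun n => ?_) fun β => ?_
  · rw [← MvPowerSeries.coeff_zero_eq_constantCoeff_apply]
    refine S.coeff_shiftedCoord_of_not w ?_ ?_
    · rintro ⟨n, h⟩
      simp at h
    · exact fun h => h.1.2.ne' (by simp [noiseHom])
  · by_cases hP : β ∈ P d Λ
    · obtain ⟨n', rfl⟩ := hP
      refine (Set.finite_Iic n').subset fun n hn => ?_
      rw [Set.mem_ofPred_eq, coeff_shiftedCoord_single] at hn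
      by_contra h
      exact hn (taylorCoeff_eq_zero _ h)
    · refine (S.finite_deg_le (S.η + S.hom β)).subset fun n hn => ?_
      by_contra h
      exact hn (S.coeff_shiftedCoord_of_not w hP fun h' => h h'.2.le)

theorem map_transl_shiftedCoord {K' : Type*} [CommRing K'] [Algebra ℝ K] [Algebra ℝ K']
    (g : K →ₐ[ℝ] K') (f : Poly d Λ) :
    MvPowerSeries.map (g : K →+* K') (S.transl (S.shiftedCoord w) f) =
      S.transl (S.shiftedCoord fun x => g (w x)) f := by
  rw [map_transl]
  congr 2
  ext1 n
  exact S.map_shiftedCoord w _ n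

end ShiftedCoord

/-! ### Differential equations -/

/-- The universal translation: its parameters are the generators of `T⁺`. -/
def univTransl : Poly d Λ →ₐ[ℝ] MvPowerSeries (Coord d Λ) S.TPlus :=
  S.transl (S.shiftedCoord MvPolynomial.X)

open Classical in
theorem mapDeriv_shiftedCoord_X (x : S.MPlus) (n : Fin d → ℕ) :
    mapDeriv (MvPolynomial.pderiv (Sum.inl x))
      (S.shiftedCoord (MvPolynomial.X : S.MPlus ⊕ Fin d → S.TPlus) n) =
      if n = x.1.2 then MvPowerSeries.monomial x.1.1.1 1 else 0 := by
  have hpoly : mapDeriv (MvPolynomial.pderiv (Sum.inl x)) (polyCoord Λ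
      (fun i => (MvPolynomial.X (Sum.inr i) : S.TPlus)) n) = 0 := by
    rw [mapDeriv_polyCoord]
    refine Finset.sum_eq_zero fun i _ => ?_
    rw [MvPolynomial.pderiv_X_of_ne Sum.inr_ne_inl, map_zero, zero_mul]
  obtain ⟨⟨⟨γ, hγ⟩, m⟩, hx⟩ := x
  rw [shiftedCoord, map_add, hpoly, zero_add]
  ext β
  rw [coeff_mapDeriv]
  by_cases h : β ∈ S.N ∧ S.deg n < S.η + S.hom β
  · rw [coeff_noisePart S _ h.1 h.2, MvPolynomial.pderiv_X, Pi.single_apply]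
    split_ifs with h1 h2 h2
    · obtain rfl : β = γ := by simp_all
      rw [MvPowerSeries.coeff_monomial_same]
    · simp_all
    · rw [MvPowerSeries.coeff_monomial_ne]
      simp_all
    · rfl
  · rw [coeff_noisePart_of_not S _ h, map_zero]
    split_ifs with hn
    · rw [MvPowerSeries.coeff_monomial_ne]
      rintro rfl
      exact h ⟨hγ, hn ▸ hx⟩
    · rfl

theorem mapDeriv_univTransl (x : S.MPlus) (f : Poly d Λ) :
    mapDeriv (MvPolynomial.pderiv (Sum.inl x)) (S.univTransl f) =
      MvPowerSeries.monomial x.1.1.1 1 * S.univTransl (S.D x.1.2 f) := by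
  classical
  refine derivation_algHom_apply S.univTransl _ _ _ (fun y => ?_) f
  rw [univTransl, transl_X]
  rcases y with ⟨l, k⟩ | n
  · rw [mapDeriv_translVar_inl S _ _ (F := {x.1.2}), Finset.sum_singleton,
      mapDeriv_shiftedCoord_X, if_pos rfl]
    intro n _ hn
    rw [mapDeriv_shiftedCoord_X] at hn
    exact Finset.mem_singleton.2 (ite_ne_right_iff.1 hn).1
  · rw [D_X_inr, translVar_inr, mapDeriv_shiftedCoord_X]
    split_ifs <;> simp

theorem mapDeriv_transl_polyCoord (i : Fin d) (f : Poly d Λ) :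
    mapDeriv (MvPolynomial.pderiv i)
      (S.transl (polyCoord Λ (MvPolynomial.X : Fin d → MvPolynomial (Fin d) ℝ)) f) =
      S.transl (polyCoord Λ MvPolynomial.X) (S.dx i f) := by
  have hpoly (n : Fin d → ℕ) : mapDeriv (MvPolynomial.pderiv i)
      (polyCoord Λ (MvPolynomial.X : Fin d → MvPolynomial (Fin d) ℝ) n) =
      (n i + 1) • polyCoord Λ MvPolynomial.X (n + Pi.single i 1) := by
    rw [mapDeriv_polyCoord, Finset.sum_eq_single_of_mem i (Finset.mem_univ i),
      MvPolynomial.pderiv_X_self, map_one, one_mul]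
    intro j _ hj
    rw [MvPolynomial.pderiv_X_of_ne hj, map_zero, zero_mul]
  rw [derivation_algHom_apply _ _ 1 (S.dx i) (fun x => ?_) f, one_mul]
  rw [transl_X, one_mul]
  rcases x with ⟨l, k⟩ | n
  · have hF (n) (hn : S.deg n < S.η) : n ∈ (S.finite_deg_le S.η).toFinset := by simpa using hn.le
    rw [mapDeriv_translVar_inl S _ _ fun n hn _ => hF n hn, dx_X_inl S i l k hF, map_sum]
    refine Finset.sum_congr rfl fun n _ => ?_
    rw [hpoly, map_nsmul, map_mul, transl_X, translVar_inr, smul_mul_assoc]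
  · rw [dx_X_inr, map_nsmul, transl_X, translVar_inr, translVar_inr, hpoly]

end Setting

/-! ### The coefficients of the universal translation -/

section DerivCoeff

variable {ι κ R : Type*} [CommSemiring R]

/-- The `k`-th derivative of a polynomial at zero. -/
def derivCoeff (k : ι →₀ ℕ) (q : MvPolynomial ι R) : R :=
  (k.prod fun _ j => j ! : ℕ) * q.coeff k

theorem derivCoeff_zero (q : MvPolynomial ι R) :
    derivCoeff 0 q = MvPolynomial.constantCoeff q := by
  rw [derivCoeff, Finsupp.prod_zero_index, Nat.cast_one, one_mul, MvPolynomial.constantCoeff_eq]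

theorem prod_factorial_add_single (k : ι →₀ ℕ) (x : ι) :
    ((k + Finsupp.single x 1).prod fun _ j => j !) = (k x + 1) * k.prod fun _ j => j ! := by
  classical
  rw [← Finsupp.mul_prod_erase' (k + Finsupp.single x 1) x _ fun _ => Nat.factorial_zero,
    ← Finsupp.mul_prod_erase' k x _ fun _ => Nat.factorial_zero, Finsupp.erase_add,
    Finsupp.erase_single, add_zero, Finsupp.add_apply, Finsupp.single_eq_same,
    Nat.factorial_succ, mul_assoc]

theorem derivCoeff_add_single (k : ι →₀ ℕ) (x : ι) (q : MvPolynomial ι R) :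
    derivCoeff (k + Finsupp.single x 1) q = derivCoeff k (MvPolynomial.pderiv x q) := by
  rw [derivCoeff, derivCoeff, prod_factorial_add_single, MvPolynomial.coeff_pderiv]
  push_cast
  ring

theorem derivCoeff_mapDomain {f : ι → κ} (hf : f.Injective) (k : ι →₀ ℕ)
    (q : MvPolynomial κ R) :
    derivCoeff (k.mapDomain f) q = derivCoeff k (MvPolynomial.killCompl hf q) := by
  rw [derivCoeff, derivCoeff, MvPolynomial.coeff_killCompl,
    Finsupp.prod_mapDomain_index_inj hf]

end DerivCoeff

/-- The word in the letters `i : Fin d` whose product is the monomial with exponents `m`. -/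
def word (m : Fin d → ℕ) : List (Fin d) := (List.ofFn fun i => List.replicate (m i) i).flatten

theorem toFinsupp_word (m : Fin d → ℕ) :
    Multiset.toFinsupp (word m : Multiset (Fin d)) = toMI m := by
  ext i
  rw [Multiset.toFinsupp_apply, Multiset.coe_count, word, List.count_flatten, List.map_ofFn,
    List.sum_ofFn]
  simp [List.count_replicate]

theorem prod_map_word {M : Type*} [Monoid M] (f : Fin d → M) (m : Fin d → ℕ) :
    ((word m).map f).prod = (List.ofFn fun i => f i ^ m i).prod := by
  rw [word, List.map_flatten, List.prod_flatten, List.map_ofFn, List.map_ofFn]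
  congr 2
  ext1 i
  simp

namespace Setting

variable (S : Setting d Λ)

theorem rho_ι (E : S.L) (f : Poly d Λ) :
    S.rho (UniversalEnvelopingAlgebra.ι ℝ E) f = (E : Derivation ℝ (Poly d Λ) (Poly d Λ)) f :=
  LinearMap.congr_fun (UniversalEnvelopingAlgebra.lift_ι_apply ℝ _ E) f

theorem rho_insertD (n : Fin d → ℕ) (U : S.UL) (f : S.TN) (g : Poly d Λ) :
    S.rho (S.insertD n U f) g = f * S.rho U (S.D n g) := by
  induction U using envelopingAlgebra_induction generalizing f g with
  | one =>
    rw [insertD_one, smulD, LinearMap.comp_apply, map_one, Module.End.one_apply]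
    exact S.rho_ι _ g
  | smul c U h =>
    have hsmul : S.insertD n (c • U) f = c • S.insertD n U f := by simp only [insertD, map_smul,
      LinearMap.smul_apply]
    rw [hsmul, map_smul, map_smul, LinearMap.smul_apply, LinearMap.smul_apply, h, mul_smul_comm]
  | add U V hU hV =>
    have hadd : S.insertD n (U + V) f = S.insertD n U f + S.insertD n V f := by
      simp only [insertD, map_add, LinearMap.add_apply]
    rw [hadd, map_add, map_add, LinearMap.add_apply, LinearMap.add_apply, hU, hV, mul_add]
  | mul E U h =>
    rw [insertD_ι_mul, map_sub, LinearMap.sub_apply, map_mul, map_mul, Module.End.mul_apply,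
      Module.End.mul_apply, h, h, rho_ι, rho_ι, Derivation.leibniz, smul_eq_mul, smul_eq_mul,
      mul_comm (S.rho U _)]
    exact add_sub_cancel_right _ _

theorem rho_insertGen (p : S.M) (U : S.UL) (g : Poly d Λ) :
    S.rho (S.insertGen p U) g = MvPolynomial.monomial p.1.1 1 * S.rho U (S.D p.2 g) :=
  S.rho_insertD _ _ _ _

theorem constantCoeff_coeff_transl {τ : Type*} {w : S.MPlus ⊕ Fin d → MvPolynomial τ ℝ}
    (hw : ∀ x, MvPolynomial.constantCoeff (w x) = 0) (f : Poly d Λ) (β : MI (Coord d Λ)) :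
    MvPolynomial.constantCoeff (MvPowerSeries.coeff β (S.transl (S.shiftedCoord w) f)) =
      f.coeff β := by
  have hzero : (fun x => MvPolynomial.aeval (0 : τ → ℝ) (w x)) = 0 := by
    ext x
    simpa using hw x
  have h := congrArg (MvPowerSeries.coeff β)
    (S.map_transl_shiftedCoord w (MvPolynomial.aeval (0 : τ → ℝ)) f)
  rw [hzero, shiftedCoord_zero, coeff_transl_X, MvPowerSeries.coeff_map] at h
  simpa using h

theorem derivCoeff_transl_rho (L : List (Fin d)) (k : MI (Fin d)) (f : Poly d Λ)
    (β : MI (Coord d Λ)) :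
    derivCoeff k (MvPowerSeries.coeff β (S.transl
      (polyCoord Λ (MvPolynomial.X : Fin d → MvPolynomial (Fin d) ℝ))
      (S.rho (L.map fun i => (UniversalEnvelopingAlgebra.ι ℝ (S.dxL i) : S.UL)).prod f))) =
    derivCoeff (k + Multiset.toFinsupp (L : Multiset (Fin d)))
      (MvPowerSeries.coeff β (S.transl (polyCoord Λ MvPolynomial.X) f)) := by
  induction L generalizing k with
  | nil => simp
  | cons i L ih =>
    rw [List.map_cons, List.prod_cons, map_mul, Module.End.mul_apply, rho_ι, dxL,
      ← mapDeriv_transl_polyCoord, coeff_mapDeriv, ← derivCoeff_add_single, ih,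
      ← Multiset.cons_coe, ← Multiset.singleton_add, Multiset.toFinsupp_add,
      Multiset.toFinsupp_singleton, add_assoc]

theorem derivCoeff_univTransl_mapDomain_inr (k : MI (Fin d)) (f : Poly d Λ)
    (β : MI (Coord d Λ)) :
    derivCoeff (k.mapDomain Sum.inr) (MvPowerSeries.coeff β (S.univTransl f)) =
      derivCoeff k (MvPowerSeries.coeff β (S.transl (polyCoord Λ MvPolynomial.X) f)) := by
  have hkill : (fun x => MvPolynomial.killCompl (R := ℝ) (Sum.inr_injective (α := S.MPlus))
      (MvPolynomial.X x)) = Sum.elim (0 : S.MPlus → MvPolynomial (Fin d) ℝ) MvPolynomial.X := by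
    ext1 (x | i) <;> simp [MvPolynomial.killCompl]
  rw [derivCoeff_mapDomain Sum.inr_injective, ← S.shiftedCoord_elim_zero, ← hkill,
    ← map_transl_shiftedCoord, MvPowerSeries.coeff_map]
  rfl

theorem constantCoeff_coeff_transl_polyCoord (f : Poly d Λ) (β : MI (Coord d Λ)) :
    MvPolynomial.constantCoeff (MvPowerSeries.coeff β
      (S.transl (polyCoord Λ (MvPolynomial.X : Fin d → MvPolynomial (Fin d) ℝ)) f)) =
      f.coeff β := by
  rw [← S.shiftedCoord_elim_zero, constantCoeff_coeff_transl]
  rintro (x | i) <;> simp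

theorem derivCoeff_univTransl_inr (m : Fin d → ℕ) (f : Poly d Λ) (β : MI (Coord d Λ)) :
    derivCoeff ((toMI m).mapDomain Sum.inr) (MvPowerSeries.coeff β (S.univTransl f)) =
      (S.rho (S.dxPow m) f).coeff β := by
  rw [derivCoeff_univTransl_mapDomain_inr, ← toFinsupp_word, ← zero_add (Multiset.toFinsupp _),
    ← derivCoeff_transl_rho, derivCoeff_zero, prod_map_word, constantCoeff_coeff_transl_polyCoord,
    dxPow]

open Classical in
theorem derivCoeff_univTransl (L : List S.MPlus) (m : Fin d → ℕ) (f : Poly d Λ)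
    (β : MI (Coord d Λ)) :
    derivCoeff (Finsupp.sumElim (Multiset.toFinsupp (L : Multiset S.MPlus)) (toMI m))
      (MvPowerSeries.coeff β (S.univTransl f)) =
    (S.rho ((L.map Subtype.val).foldr S.insertGen (S.dxPow m)) f).coeff β := by
  induction L generalizing f β with
  | nil =>
    rw [Multiset.coe_nil, Multiset.toFinsupp_zero, Finsupp.sumElim_eq_add, Finsupp.mapDomain_zero,
      zero_add]
    exact S.derivCoeff_univTransl_inr m f β
  | cons x L ih =>
    have hcons : Finsupp.sumElim (Multiset.toFinsupp ((x :: L : List _) : Multiset S.MPlus))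
        (toMI m) = Finsupp.sumElim (Multiset.toFinsupp (L : Multiset S.MPlus)) (toMI m) +
          Finsupp.single (Sum.inl x) 1 := by
      rw [← Finsupp.sumElim_single_zero, ← Finsupp.sumElim_add, add_zero, ← Multiset.cons_coe,
        ← Multiset.singleton_add, Multiset.toFinsupp_add, Multiset.toFinsupp_singleton, add_comm]
    rw [hcons, derivCoeff_add_single, ← coeff_mapDeriv, mapDeriv_univTransl, List.map_cons,
      List.foldr_cons, rho_insertGen, MvPolynomial.coeff_monomial_mul',
      MvPowerSeries.coeff_monomial_mul]
    split_ifs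
    · rw [one_mul, one_mul, ih]
    · rw [derivCoeff, MvPolynomial.coeff_zero, mul_zero]

theorem actCoeffPlus_eq_coeff_univTransl (J : MI S.MPlus) (m : Fin d → ℕ)
    (β γ : MI (Coord d Λ)) :
    S.actCoeffPlus J m β γ = (MvPowerSeries.coeff β (S.univTransl
      (MvPolynomial.monomial γ 1))).coeff (Finsupp.sumElim J (toMI m)) := by
  classical
  obtain ⟨L, hL⟩ : (Finsupp.toMultiset (J.mapDomain Subtype.val)).toList ∈
      Set.range (List.map (Subtype.val : S.MPlus → S.M)) := by
    rw [Set.range_list_map]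
    intro x hx
    rw [Multiset.mem_toList, ← Finsupp.toMultiset_map, Multiset.mem_map] at hx
    obtain ⟨y, -, rfl⟩ := hx
    exact ⟨y, rfl⟩
  have hJ : Multiset.toFinsupp (L : Multiset S.MPlus) = J := by
    rw [Multiset.toFinsupp_eq_iff]
    refine Multiset.map_injective Subtype.val_injective ?_
    rw [Finsupp.toMultiset_map, Multiset.map_coe, hL, Multiset.coe_toList]
  have hfactorial : ((Finsupp.sumElim J (toMI m)).prod fun _ j => j !) =
      ((J.mapDomain Subtype.val).prod fun _ j => j !) * ∏ i, (m i)! := by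
    rw [Finsupp.prod_sumElim, Finsupp.prod_mapDomain_index_inj Subtype.val_injective,
      Finsupp.prod_fintype (toMI m)]
    · rfl
    · exact fun _ => Nat.factorial_zero
  have hne : (((Finsupp.sumElim J (toMI m)).prod fun _ j => j ! : ℕ) : ℝ) ≠ 0 :=
    Nat.cast_ne_zero.2 (Finset.prod_ne_zero_iff.2 fun _ _ => Nat.factorial_ne_zero _)
  rw [actCoeffPlus, actCoeff, DJm, map_smul, LinearMap.smul_apply, MvPolynomial.coeff_smul,
    smul_eq_mul, ← hL, ← derivCoeff_univTransl, hJ, derivCoeff, ← hfactorial,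
    inv_mul_cancel_left₀ hne]

end Setting

/-! ### Homogeneities -/

section Weight

variable {I : Type*}

theorem weight_eq_sum_mul (w : I → ℝ) (f : I →₀ ℕ) :
    Finsupp.weight w f = f.sum fun i j => w i * j := by
  rw [Finsupp.weight_apply]
  simp only [nsmul_eq_mul, mul_comm]

theorem weight_nonneg_of_support {w : I → ℝ} {f : I →₀ ℕ} (hw : ∀ i, f i ≠ 0 → 0 ≤ w i) :
    0 ≤ Finsupp.weight w f := by
  rw [Finsupp.weight_apply]
  exact Finset.sum_nonneg fun i hi => nsmul_nonneg (hw i (Finsupp.mem_support_iff.1 hi)) _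

theorem mul_le_weight {w : I → ℝ} {f : I →₀ ℕ} (hw : ∀ i, f i ≠ 0 → 0 ≤ w i) (i : I) :
    w i * f i ≤ Finsupp.weight w f := by
  by_cases hi : f i = 0
  · rw [hi, Nat.cast_zero, mul_zero]
    exact weight_nonneg_of_support hw
  · rw [weight_eq_sum_mul]
    exact Finset.single_le_sum (f := fun i => w i * (f i : ℝ))
      (fun j hj => mul_nonneg (hw j (Finsupp.mem_support_iff.1 hj)) (Nat.cast_nonneg _))
      (Finsupp.mem_support_iff.2 hi)

theorem le_weight_of_support {w : I → ℝ} {f : I →₀ ℕ} (hw : ∀ i, f i ≠ 0 → 0 ≤ w i) {i : I}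
    (hi : f i ≠ 0) : w i ≤ Finsupp.weight w f :=
  (le_mul_of_one_le_right (hw i hi) (Nat.one_le_cast.2 (Nat.one_le_iff_ne_zero.2 hi))).trans
    (mul_le_weight hw i)

theorem weight_congr {M : Type*} [AddCommMonoid M] {w w' : I → M} {f : I →₀ ℕ}
    (h : ∀ i, f i ≠ 0 → w i = w' i) : Finsupp.weight w f = Finsupp.weight w' f := by
  rw [Finsupp.weight_apply, Finsupp.weight_apply]
  exact Finsupp.sum_congr fun i hi => by rw [h i (Finsupp.mem_support_iff.1 hi)]

theorem finite_weight_le {F : Set I} (hF : F.Finite) {w : I → ℝ} (hw : ∀ i ∈ F, 0 < w i) (C : ℝ) :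
    {f : I →₀ ℕ | (∀ i, f i ≠ 0 → i ∈ F) ∧ Finsupp.weight w f ≤ C}.Finite := by
  classical
  refine (Set.finite_Iic (Finsupp.indicator hF.toFinset fun i _ => ⌈C / w i⌉₊)).subset ?_
  rintro f ⟨hf, hC⟩ i
  by_cases hi : f i = 0
  · exact hi ▸ Nat.zero_le _
  · rw [Finsupp.indicator_of_mem (hF.mem_toFinset.2 (hf i hi))]
    refine Nat.cast_le.1 (le_trans ?_ (Nat.le_ceil (C / w i)))
    rw [le_div_iff₀ (hw i (hf i hi)), mul_comm]
    exact (mul_le_weight (fun j hj => (hw j (hf j hj)).le) i).trans hC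

theorem finite_image_weight (u : I → ℝ) {W : Set ℝ} (hW : W.Finite) (C : ℝ) :
    (Finsupp.weight u '' {f : I →₀ ℕ | (∀ i, f i ≠ 0 → u i ∈ W) ∧
      Finsupp.weight (fun i => |u i|) f ≤ C}).Finite := by
  classical
  refine ((finite_weight_le (hW.subset (Set.sdiff_subset (t := {0}))) (w := fun v => |v|)
    (fun v hv => abs_pos.2 hv.2) C).image (Finsupp.weight id)).subset ?_
  rintro _ ⟨f, ⟨hf, hC⟩, rfl⟩
  have hweight (q : ℝ → ℝ) (hq : q 0 = 0) :
      Finsupp.weight q ((f.mapDomain u).erase 0) = Finsupp.weight (fun i => q (u i)) f := by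
    have hmap : Finsupp.weight q (f.mapDomain u) = Finsupp.weight (fun i => q (u i)) f :=
      Finsupp.linearCombination_mapDomain ℕ u f
    rw [← hmap, ← Finsupp.single_add_erase 0 (f.mapDomain u), map_add, Finsupp.weight_single, hq,
      smul_zero, zero_add, Finsupp.single_add_erase]
  refine ⟨(f.mapDomain u).erase 0, ⟨fun v hv => ?_, (hweight _ abs_zero).trans_le hC⟩,
    hweight id rfl⟩
  have hv0 : v ≠ 0 := by
    rintro rfl
    exact hv Finsupp.erase_same
  rw [Finsupp.erase_ne hv0, ← Finsupp.mem_support_iff] at hv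
  obtain ⟨i, hi, rfl⟩ := Finset.mem_image.1 (Finsupp.mapDomain_support hv)
  exact ⟨hf i (Finsupp.mem_support_iff.1 hi), hv0⟩

theorem wellFounded_lt_of_finite {f : I → ℝ} (h : ∀ b, {t ∈ Set.range f | t ≤ b}.Finite) :
    WellFounded fun i j => f i < f j := by
  have hfin (j : I) : {t ∈ Set.range f | t < f j}.Finite :=
    (h (f j)).subset fun t ht => ⟨ht.1, ht.2.le⟩
  refine Subrelation.wf (r := InvImage (· < ·) fun j => {t ∈ Set.range f | t < f j}.ncard)
    (fun {i j} hij => ?_) (InvImage.wf _ wellFounded_lt)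
  exact Set.ncard_lt_ncard ⟨fun t ht => ⟨ht.1, ht.2.trans hij⟩,
    fun hsub => lt_irrefl _ (hsub ⟨Set.mem_range_self i, hij⟩).2⟩ (hfin j)

end Weight

namespace Setting

variable (S : Setting d Λ)

/-- The homogeneity of a coordinate. -/
def homWeight : Coord d Λ → ℝ :=
  Sum.elim (fun lk => S.α lk.1 + lk.2.sum fun n j => (S.η - S.deg n) * j) fun n => S.deg n - S.η

theorem hom_eq_weight (β : MI (Coord d Λ)) : S.hom β = Finsupp.weight S.homWeight β := by
  rw [weight_eq_sum_mul, hom]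
  simp only [homWeight, mul_comm]

theorem hom_add (β γ : MI (Coord d Λ)) : S.hom (β + γ) = S.hom β + S.hom γ := by
  simp only [hom_eq_weight, map_add]

theorem hom_single (x : Coord d Λ) : S.hom (Finsupp.single x 1) = S.homWeight x := by
  rw [hom_eq_weight, Finsupp.weight_single, one_smul]

theorem homWeight_inr (n : Fin d → ℕ) : S.homWeight (Sum.inr n) = S.deg n - S.η := rfl

theorem homWeight_inl (l : Option Λ) (k : MI (Fin d → ℕ)) : S.homWeight (Sum.inl (l, k)) =
    S.α l + Finsupp.weight (fun n => S.η - S.deg n) k := by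
  rw [weight_eq_sum_mul]
  rfl

/-- The contribution of a coordinate to `|β| + (η - r) [β]`, which is nonnegative for the
coordinates occurring in `N₋`. -/
def subWeight : Coord d Λ → ℝ :=
  Sum.elim
    (fun lk => S.α lk.1 + (S.η - S.regsol) + Finsupp.weight (fun n => S.regsol - S.deg n) lk.2)
    fun n => S.deg n - S.regsol

theorem weight_subWeight (β : MI (Coord d Λ)) :
    Finsupp.weight S.subWeight β = S.hom β + (S.η - S.regsol) * bracket β := by
  induction β using Finsupp.induction_linear with
  | zero => simp [hom, bracket]
  | add β γ hβ hγ => rw [map_add, hβ, hγ, hom_add, bracket_add]; push_cast; ring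
  | single x j =>
    rw [Finsupp.weight_single, hom_eq_weight, Finsupp.weight_single, bracket,
      Finsupp.sum_single_index (zero_mul _), nsmul_eq_mul, nsmul_eq_mul, Int.cast_mul,
      Int.cast_natCast, mul_left_comm, ← mul_add]
    congr 1
    rcases x with ⟨l, k⟩ | n
    · have hsplit : Finsupp.weight (fun n => S.η - S.deg n) k =
          (S.η - S.regsol) * ((k.sum fun _ j => j : ℕ) : ℝ) +
            Finsupp.weight (fun n => S.regsol - S.deg n) k := by
        simp only [weight_eq_sum_mul, Finsupp.sum, Nat.cast_sum, Finset.mul_sum,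
          ← Finset.sum_add_distrib]
        exact Finset.sum_congr rfl fun n _ => by ring
      rw [homWeight_inl, hsplit, subWeight, Sum.elim_inl, Sum.elim_inl]
      push_cast
      ring
    · rw [homWeight_inr, subWeight, Sum.elim_inr, Sum.elim_inr, Int.cast_one]
      ring

variable {S}

theorem Subcritical.lt_add_weight {l : Option Λ} {k k' : MI (Fin d → ℕ)} (h : S.Subcritical l k)
    (hk : k' ≤ k) :
    S.regsol < S.η + S.reg l + Finsupp.weight (fun n => S.regsol - S.deg n) k' := by
  by_cases h0 : k' = 0
  · simpa only [h0, map_zero, add_zero] using h.1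
  · rw [weight_eq_sum_mul, add_assoc]
    exact (h.2 k' h0 hk).2

theorem Subcritical.subWeight_pos {l : Option Λ} {k : MI (Fin d → ℕ)} (h : S.Subcritical l k) :
    0 < S.subWeight (Sum.inl (l, k)) := by
  rw [subWeight, Sum.elim_inl]
  linarith [h.lt_add_weight le_rfl, S.reg_lt l]

theorem Subcritical.weight_abs_le {l : Option Λ} {k : MI (Fin d → ℕ)} (h : S.Subcritical l k) :
    Finsupp.weight (fun n => |S.regsol - S.deg n|) k ≤
      Finsupp.weight (fun n => S.regsol - S.deg n) k + 2 * (S.η + S.reg l - S.regsol) := by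
  classical
  set k₁ := k.filter fun n => S.regsol < S.deg n
  set k₂ := k.filter fun n => ¬ S.regsol < S.deg n
  have hk : k₁ + k₂ = k := Finsupp.filter_add_filter_not k _
  have habs₁ : Finsupp.weight (fun n => |S.regsol - S.deg n|) k₁ =
      -Finsupp.weight (fun n => S.regsol - S.deg n) k₁ := by
    rw [weight_eq_sum_mul, weight_eq_sum_mul, Finsupp.sum, Finsupp.sum, ← Finset.sum_neg_distrib]
    refine Finset.sum_congr rfl fun n hn => ?_
    rw [Finsupp.support_filter, Finset.mem_filter] at hn
    rw [abs_of_neg (sub_neg.2 hn.2), neg_mul]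
  have habs₂ : Finsupp.weight (fun n => |S.regsol - S.deg n|) k₂ =
      Finsupp.weight (fun n => S.regsol - S.deg n) k₂ := weight_congr fun n hn => by
    rw [← Finsupp.mem_support_iff, Finsupp.support_filter, Finset.mem_filter] at hn
    rw [abs_of_nonneg (sub_nonneg.2 (not_lt.1 hn.2))]
  have hlt := h.lt_add_weight (k' := k₁) (hk ▸ le_self_add)
  rw [← hk, map_add, map_add, habs₁, habs₂]
  linarith

theorem subWeight_nonneg {β : MI (Coord d Λ)} (hβ : β ∈ S.NMin) (x : Coord d Λ) (hx : β x ≠ 0) :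
    0 ≤ S.subWeight x := by
  rcases x with ⟨l, k⟩ | n
  · exact (hβ.2.1 l k hx).subWeight_pos.le
  · exact sub_nonneg.2 (not_lt.1 fun h => hx (hβ.2.2 n h))

theorem weight_subWeight_of_mem {β : MI (Coord d Λ)} (hβ : β ∈ S.NMin) :
    Finsupp.weight S.subWeight β = S.hom β + (S.η - S.regsol) := by
  rw [weight_subWeight, hβ.1, Int.cast_one, mul_one]

theorem le_hom {β : MI (Coord d Λ)} (hβ : β ∈ S.NMin) : S.regsol - S.η ≤ S.hom β := by
  have h := weight_nonneg_of_support (subWeight_nonneg hβ)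
  rw [weight_subWeight_of_mem hβ] at h
  linarith

variable (S)

theorem finite_subWeight_inl_le [Finite Λ] (c : ℝ) :
    ((fun lk => S.subWeight (Sum.inl lk)) ''
      {lk | S.Subcritical lk.1 lk.2 ∧ S.subWeight (Sum.inl lk) ≤ c}).Finite := by
  have hW : ((fun n => S.regsol - S.deg n) '' {n | S.deg n ≤ S.η}).Finite :=
    (S.finite_deg_le S.η).image _
  refine (Set.finite_iUnion fun l : Option Λ => (finite_image_weight (fun n => S.regsol - S.deg n)
    hW (c - S.α l - (S.η - S.regsol) + 2 * (S.η + S.reg l - S.regsol))).image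
      fun t => S.α l + (S.η - S.regsol) + t).subset ?_
  rintro _ ⟨⟨l, k⟩, ⟨hsub, hc⟩, rfl⟩
  refine Set.mem_iUnion.2 ⟨l, _, ⟨k, ⟨fun n hn => ⟨n, (hsub.deg_lt hn).le, rfl⟩, ?_⟩, rfl⟩, rfl⟩
  rw [subWeight, Sum.elim_inl] at hc
  linarith [hsub.weight_abs_le]

theorem finite_hom_le [Finite Λ] (b : ℝ) : {t ∈ S.hom '' S.NMin | t ≤ b}.Finite := by
  set c := b + (S.η - S.regsol)
  have hW := (S.finite_subWeight_inl_le c).union ((S.finite_deg_le (b + S.η)).image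
    fun n => S.deg n - S.regsol)
  refine ((finite_image_weight S.subWeight hW c).image fun t => t - (S.η - S.regsol)).subset ?_
  rintro _ ⟨⟨β, hβ, rfl⟩, hb⟩
  have hweight := weight_subWeight_of_mem hβ
  have hnonneg := subWeight_nonneg hβ
  have hle (x) (hx : β x ≠ 0) : S.subWeight x ≤ c :=
    (le_weight_of_support hnonneg hx).trans (by linarith)
  refine ⟨_, ⟨β, ⟨fun x hx => ?_, ?_⟩, rfl⟩, sub_eq_iff_eq_add.2 hweight⟩
  · rcases x with lk | n
    · exact Or.inl ⟨lk, ⟨hβ.2.1 lk.1 lk.2 hx, hle _ hx⟩, rfl⟩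
    · refine Or.inr ⟨n, ?_, rfl⟩
      have hn : S.deg n - S.regsol ≤ b + (S.η - S.regsol) := hle _ hx
      exact (by linarith : S.deg n ≤ b + S.η)
  · rw [weight_congr fun x hx => abs_of_nonneg (hnonneg x hx), hweight]
    linarith

theorem wellFoundedOn_hom [Finite Λ] : S.N.WellFoundedOn fun γ β => S.hom γ < S.hom β :=
  wellFounded_lt_of_finite fun b => (S.finite_hom_le b).subset <| by
    rintro _ ⟨⟨β, rfl⟩, hb⟩
    exact ⟨⟨β, β.2.1, rfl⟩, hb⟩

theorem bddBelow_A : BddBelow S.A := by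
  refine ⟨min (S.regsol - S.η) (min S.regsol 0), ?_⟩
  rintro _ (⟨β, hβ, rfl⟩ | ⟨β, ⟨n, rfl⟩ | hβ, rfl⟩)
  · exact (min_le_left _ _).trans (le_hom hβ)
  · refine (min_le_right _ _).trans ((min_le_right _ _).trans ?_)
    dsimp only
    rw [hom_single, homWeight_inr, sub_add_cancel]
    exact S.deg_nonneg n
  · refine (min_le_right _ _).trans ((min_le_left _ _).trans ?_)
    dsimp only
    linarith [le_hom hβ.1]

theorem finite_A_le [Finite Λ] (b : ℝ) : {t ∈ S.A | t ≤ b}.Finite := by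
  refine ((S.finite_hom_le b).union (((S.finite_deg_le b).image S.deg).union
    ((S.finite_hom_le (b - S.η)).image fun t => t + S.η))).subset ?_
  rintro _ ⟨⟨β, hβ, rfl⟩ | ⟨β, ⟨n, rfl⟩ | hβ, rfl⟩, hb⟩
  · exact Or.inl ⟨⟨β, hβ, rfl⟩, hb⟩
  · dsimp only at hb ⊢
    rw [hom_single, homWeight_inr, sub_add_cancel] at hb ⊢
    exact Or.inr (Or.inl ⟨n, hb, rfl⟩)
  · exact Or.inr (Or.inr ⟨S.hom β, ⟨⟨β, hβ.1, rfl⟩, le_sub_iff_add_le.2 hb⟩, rfl⟩)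

end Setting

/-! ### Triangularity of translations -/

theorem finsupp_nat_induction {I : Type*} {p : (I →₀ ℕ) → Prop} (zero : p 0)
    (add_single : ∀ f i, p f → p (f + Finsupp.single i 1)) (f : I →₀ ℕ) : p f := by
  classical
  rw [← Finsupp.toMultiset_toFinsupp f]
  induction Finsupp.toMultiset f using Multiset.induction with
  | empty => rwa [Multiset.toFinsupp_zero]
  | cons i s ih =>
    rw [← Multiset.singleton_add, Multiset.toFinsupp_add, Multiset.toFinsupp_singleton, add_comm]
    exact add_single _ _ ih

theorem isWeightedHomogeneous_derivation {σ R M : Type*} [CommSemiring R] [AddCommMonoid M]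
    {w : σ → M} {c : M} {E : Derivation R (MvPolynomial σ R) (MvPolynomial σ R)}
    (hE : ∀ x, MvPolynomial.IsWeightedHomogeneous w (E (MvPolynomial.X x)) (w x + c))
    {f : MvPolynomial σ R} {a : M} (hf : MvPolynomial.IsWeightedHomogeneous w f a) :
    MvPolynomial.IsWeightedHomogeneous w (E f) (a + c) := by
  have hmonomial (γ : σ →₀ ℕ) (r : R) : MvPolynomial.IsWeightedHomogeneous w
      (E (MvPolynomial.monomial γ r)) (Finsupp.weight w γ + c) := by
    induction γ using finsupp_nat_induction with
    | zero =>
      rw [← MvPolynomial.C_apply, MvPolynomial.derivation_C]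
      exact MvPolynomial.isWeightedHomogeneous_zero _ _ _
    | add_single γ x ih =>
      rw [MvPolynomial.monomial_add_single, pow_one, E.leibniz, smul_eq_mul, smul_eq_mul, map_add,
        Finsupp.weight_single, one_smul]
      refine MvPolynomial.IsWeightedHomogeneous.add ?_ ?_
      · rw [add_assoc]
        exact (MvPolynomial.isWeightedHomogeneous_monomial w γ r rfl).mul (hE x)
      · rw [add_comm _ (w x), add_assoc]
        exact (MvPolynomial.isWeightedHomogeneous_X R w x).mul ih
  rw [MvPolynomial.as_sum f, map_sum]
  refine MvPolynomial.IsWeightedHomogeneous.sum _ _ _ fun γ hγ => ?_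
  rw [← hf (MvPolynomial.mem_support_iff.1 hγ)]
  exact hmonomial γ _

namespace Setting

variable (S : Setting d Λ) {f : Poly d Λ} {a : ℝ}

theorem isWeightedHomogeneous_nsmul_X (j : ℕ) {x : Coord d Λ} (h : S.homWeight x = a) :
    MvPolynomial.IsWeightedHomogeneous S.homWeight
      (j • (MvPolynomial.X x : Poly d Λ)) a := by
  subst h
  exact (MvPolynomial.weightedHomogeneousSubmodule ℝ _ _).nsmul_mem
    (MvPolynomial.isWeightedHomogeneous_X ℝ _ x) j

theorem isWeightedHomogeneous_D (n : Fin d → ℕ)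
    (hf : MvPolynomial.IsWeightedHomogeneous S.homWeight f a) :
    MvPolynomial.IsWeightedHomogeneous S.homWeight (S.D n f) (a + (S.η - S.deg n)) := by
  classical
  refine isWeightedHomogeneous_derivation (fun x => ?_) hf
  rcases x with ⟨l, k⟩ | m
  · rw [D_X_inl]
    split_ifs
    · refine S.isWeightedHomogeneous_nsmul_X _ ?_
      rw [homWeight_inl, homWeight_inl, map_add, Finsupp.weight_single, one_smul, add_assoc]
    · exact MvPolynomial.isWeightedHomogeneous_zero _ _ _
  · rw [D_X_inr]
    split_ifs with h
    · rw [h, homWeight_inr, sub_add_sub_cancel', sub_self]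
      exact MvPolynomial.isWeightedHomogeneous_one _ _
    · exact MvPolynomial.isWeightedHomogeneous_zero _ _ _

theorem isWeightedHomogeneous_dx (i : Fin d)
    (hf : MvPolynomial.IsWeightedHomogeneous S.homWeight f a) :
    MvPolynomial.IsWeightedHomogeneous S.homWeight (S.dx i f) (a + S.s i) := by
  refine isWeightedHomogeneous_derivation (fun x => ?_) hf
  rcases x with ⟨l, k⟩ | m
  · have hF (n) (hn : S.deg n < S.η) : n ∈ (S.finite_deg_le S.η).toFinset := by simpa using hn.le
    rw [dx_X_inl S i l k hF]
    refine MvPolynomial.IsWeightedHomogeneous.sum _ _ _ fun n _ => ?_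
    rw [← smul_mul_assoc]
    have hX := S.isWeightedHomogeneous_nsmul_X (n i + 1)
      (S.homWeight_inr (n + Pi.single i 1))
    convert hX.mul (S.isWeightedHomogeneous_D n
      (MvPolynomial.isWeightedHomogeneous_X ℝ S.homWeight (Sum.inl (l, k)))) using 1
    rw [deg_add_single]
    ring
  · rw [dx_X_inr]
    refine S.isWeightedHomogeneous_nsmul_X _ ?_
    rw [homWeight_inr, homWeight_inr, deg_add_single, add_sub_right_comm]

/-- The degree of a generator of `T⁺`: the amount by which the corresponding generator of `L`
raises the homogeneity. -/
def degPlus : S.MPlus ⊕ Fin d → ℝ :=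
  Sum.elim (fun x => S.η + S.hom x.1.1 - S.deg x.1.2) S.s

theorem degPlus_pos (x : S.MPlus ⊕ Fin d) : 0 < S.degPlus x := by
  rcases x with x | i
  · exact sub_pos.2 x.2
  · exact S.s_pos i

theorem weight_degPlus_nonneg (Q : MI (S.MPlus ⊕ Fin d)) : 0 ≤ Finsupp.weight S.degPlus Q :=
  weight_nonneg_of_support fun x _ => (S.degPlus_pos x).le

theorem weight_degPlus_pos {Q : MI (S.MPlus ⊕ Fin d)} (hQ : Q ≠ 0) :
    0 < Finsupp.weight S.degPlus Q := by
  obtain ⟨x, hx⟩ := Finsupp.ne_iff.1 hQ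
  exact (S.degPlus_pos x).trans_le (le_weight_of_support (fun x _ => (S.degPlus_pos x).le) hx)

theorem hom_eq_of_derivCoeff_transl_polyCoord_ne_zero {k : MI (Fin d)} {β : MI (Coord d Λ)}
    (hf : MvPolynomial.IsWeightedHomogeneous S.homWeight f a)
    (h : derivCoeff k (MvPowerSeries.coeff β (S.transl
      (polyCoord Λ (MvPolynomial.X : Fin d → MvPolynomial (Fin d) ℝ)) f)) ≠ 0) :
    S.hom β = a + Finsupp.weight S.s k := by
  induction k using finsupp_nat_induction generalizing f a with
  | zero =>
    rw [derivCoeff_zero, constantCoeff_coeff_transl_polyCoord] at h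
    rw [hom_eq_weight, hf h, map_zero, add_zero]
  | add_single k i ih =>
    rw [derivCoeff_add_single, ← coeff_mapDeriv, mapDeriv_transl_polyCoord] at h
    rw [ih (S.isWeightedHomogeneous_dx i hf) h, map_add, Finsupp.weight_single, one_smul]
    ring

theorem hom_eq_of_derivCoeff_univTransl_ne_zero {J : MI S.MPlus} {k : MI (Fin d)}
    {β : MI (Coord d Λ)} (hf : MvPolynomial.IsWeightedHomogeneous S.homWeight f a)
    (h : derivCoeff (Finsupp.sumElim J k) (MvPowerSeries.coeff β (S.univTransl f)) ≠ 0) :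
    S.hom β = a + Finsupp.weight S.degPlus (Finsupp.sumElim J k) := by
  classical
  induction J using finsupp_nat_induction generalizing f a β with
  | zero =>
    rw [Finsupp.sumElim_eq_add, Finsupp.mapDomain_zero, zero_add] at h ⊢
    rw [derivCoeff_univTransl_mapDomain_inr] at h
    have hdeg : Finsupp.weight S.degPlus (k.mapDomain Sum.inr) = Finsupp.weight S.s k :=
      Finsupp.linearCombination_mapDomain ℕ Sum.inr k
    rw [S.hom_eq_of_derivCoeff_transl_polyCoord_ne_zero hf h, hdeg]
  | add_single J x ih =>
    have hJ : Finsupp.sumElim (J + Finsupp.single x 1) k =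
        Finsupp.sumElim J k + Finsupp.single (Sum.inl x) 1 := by
      rw [← Finsupp.sumElim_single_zero, ← Finsupp.sumElim_add, add_zero]
    rw [hJ, derivCoeff_add_single, ← coeff_mapDeriv, mapDeriv_univTransl,
      MvPowerSeries.coeff_monomial_mul] at h
    split_ifs at h with hle
    · rw [one_mul] at h
      have hx : S.degPlus (Sum.inl x) = S.η + S.hom x.1.1 - S.deg x.1.2 := rfl
      rw [hJ, map_add, Finsupp.weight_single, one_smul, ← tsub_add_cancel_of_le hle, hom_add,
        ih (S.isWeightedHomogeneous_D x.1.2 hf) h, hx]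
      ring
    · rw [derivCoeff, MvPolynomial.coeff_zero, mul_zero] at h
      exact absurd rfl h

variable {S} {β γ : MI (Coord d Λ)}

theorem hom_eq_of_coeff_univTransl_ne_zero {Q : MI (S.MPlus ⊕ Fin d)}
    (h : (MvPowerSeries.coeff β (S.univTransl (MvPolynomial.monomial γ 1))).coeff Q ≠ 0) :
    S.hom β = S.hom γ + Finsupp.weight S.degPlus Q := by
  obtain ⟨⟨J, k⟩, rfl⟩ := Finsupp.sumFinsuppEquivProdFinsupp.symm.surjective Q
  have hγ : MvPolynomial.IsWeightedHomogeneous S.homWeight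
      (MvPolynomial.monomial γ (1 : ℝ)) (S.hom γ) :=
    MvPolynomial.isWeightedHomogeneous_monomial _ _ _ (S.hom_eq_weight γ).symm
  refine S.hom_eq_of_derivCoeff_univTransl_ne_zero hγ ?_
  exact mul_ne_zero (Nat.cast_ne_zero.2
    (Finset.prod_ne_zero_iff.2 fun _ _ => Nat.factorial_ne_zero _)) h

variable (S) in
theorem rho_mem_TN (U : S.UL) (hf : f ∈ S.TN) : S.rho U f ∈ S.TN := by
  induction U using envelopingAlgebra_induction with
  | one => rwa [map_one]
  | smul c U h => rw [map_smul]; exact Submodule.smul_mem _ c h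
  | add U V hU hV => rw [map_add]; exact Submodule.add_mem _ hU hV
  | mul E U h =>
    rw [map_mul, Module.End.mul_apply, rho_ι]
    exact S.L_mem E.2 h

theorem mem_N_of_coeff_univTransl_ne_zero {Q : MI (S.MPlus ⊕ Fin d)}
    (h : (MvPowerSeries.coeff β (S.univTransl (MvPolynomial.monomial γ 1))).coeff Q ≠ 0)
    (hγ : γ ∈ S.N) : β ∈ S.N := by
  obtain ⟨⟨J, k⟩, rfl⟩ := Finsupp.sumFinsuppEquivProdFinsupp.symm.surjective Q
  obtain ⟨m, rfl⟩ := Finsupp.equivFunOnFinite.symm.surjective k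
  have hact : S.actCoeffPlus J m β γ ≠ 0 := by
    rw [actCoeffPlus_eq_coeff_univTransl]
    exact h
  exact (MvPolynomial.mem_restrictSupport_iff _).1 (S.rho_mem_TN _ (S.monomial_mem hγ 1))
    (MvPolynomial.mem_support_iff.2 hact)

theorem coeff_univTransl_of_not_lt (h : ¬ S.hom γ < S.hom β) :
    MvPowerSeries.coeff β (S.univTransl (MvPolynomial.monomial γ 1)) =
      MvPolynomial.C ((MvPolynomial.monomial γ (1 : ℝ)).coeff β) := by
  classical
  ext Q
  rw [MvPolynomial.coeff_C]
  split_ifs with hQ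
  · rw [← hQ]
    exact S.constantCoeff_coeff_transl (fun x => MvPolynomial.constantCoeff_X _ _) _ _
  · by_contra hne
    rw [hom_eq_of_coeff_univTransl_ne_zero hne] at h
    exact h (lt_add_of_pos_right _ (S.weight_degPlus_pos (Ne.symm hQ)))

variable (S) (w : S.MPlus ⊕ Fin d → ℝ)

theorem coeff_transl_eq_aeval (f : Poly d Λ) (β : MI (Coord d Λ)) :
    MvPowerSeries.coeff β (S.transl (S.shiftedCoord w) f) =
      MvPolynomial.aeval w (MvPowerSeries.coeff β (S.univTransl f)) := by
  have hX : (fun x => MvPolynomial.aeval w (MvPolynomial.X x : S.TPlus)) = w := by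
    ext1 x
    rw [MvPolynomial.aeval_X]
  conv_lhs => rw [← hX, ← map_transl_shiftedCoord, MvPowerSeries.coeff_map]
  rfl

theorem coeff_transl_of_not_lt (h : ¬ S.hom γ < S.hom β) :
    MvPowerSeries.coeff β (S.transl (S.shiftedCoord w) (MvPolynomial.monomial γ 1)) =
      (MvPolynomial.monomial γ (1 : ℝ)).coeff β := by
  rw [coeff_transl_eq_aeval, coeff_univTransl_of_not_lt h, MvPolynomial.aeval_C]
  rfl

variable {w}

theorem exists_coeff_univTransl_ne_zero
    (h : MvPowerSeries.coeff β (S.transl (S.shiftedCoord w) f) ≠ 0) :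
    ∃ Q, (MvPowerSeries.coeff β (S.univTransl f)).coeff Q ≠ 0 := by
  rw [coeff_transl_eq_aeval] at h
  exact MvPolynomial.ne_zero_iff.1 fun h0 => h (by rw [h0, map_zero])

theorem hom_le_of_coeff_transl_ne_zero
    (h : MvPowerSeries.coeff β (S.transl (S.shiftedCoord w) (MvPolynomial.monomial γ 1)) ≠ 0) :
    S.hom γ ≤ S.hom β := by
  obtain ⟨Q, hQ⟩ := S.exists_coeff_univTransl_ne_zero h
  rw [hom_eq_of_coeff_univTransl_ne_zero hQ]
  exact le_add_of_nonneg_right (S.weight_degPlus_nonneg Q)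

theorem mem_N_of_coeff_transl_ne_zero
    (h : MvPowerSeries.coeff β (S.transl (S.shiftedCoord w) (MvPolynomial.monomial γ 1)) ≠ 0)
    (hγ : γ ∈ S.N) : β ∈ S.N := by
  obtain ⟨Q, hQ⟩ := S.exists_coeff_univTransl_ne_zero h
  exact mem_N_of_coeff_univTransl_ne_zero hQ hγ

end Setting

/-! ### The composition of translations -/

namespace Setting

variable (S : Setting d Λ)

section Subst

variable {K : Type*} [CommRing K] {y₁ y₂ : (Fin d → ℕ) → MvPowerSeries (Coord d Λ) K}

theorem subst_taylorRow_mul_translVar (ha : MvPowerSeries.HasSubst (S.translVar y₂))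
    (l : Option Λ) (k j : MI (Fin d → ℕ)) :
    MvPowerSeries.subst (S.translVar y₂) (S.taylorRow y₁ l k j) * S.translVar y₂ (Sum.inl (l, j)) =
      varSum (inlEmb d l)
        (taylorCoeff (fun n => MvPowerSeries.subst (S.translVar y₂) (y₁ n) - y₂ n) j k •
          S.taylorRow y₂ l j) := by
  by_cases h : S.Subcritical l j
  · have hsubst : MvPowerSeries.substAlgHom ha (S.taylorRow y₁ l k j) =
        taylorCoeff (fun n => MvPowerSeries.substAlgHom ha (y₁ n) - y₂ n) j k := by
      rw [taylorRow, if_pos h]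
      refine (map_taylorCoeff (MvPowerSeries.substAlgHom (R := K) ha :
        MvPowerSeries (Coord d Λ) K →+* MvPowerSeries (Coord d Λ) K) _ j k).trans ?_
      congr 1
      ext1 n
      exact (map_sub (MvPowerSeries.substAlgHom ha) _ _).trans
        (congrArg _ (MvPowerSeries.substAlgHom_X ha _))
    simp only [MvPowerSeries.substAlgHom_apply] at hsubst
    rw [hsubst, translVar_inl_of_subcritical S _ h, map_smul, smul_eq_mul]
  · rw [taylorRow, if_neg h, taylorRow_of_not_subcritical S y₂ h, smul_zero, map_zero,
      ← MvPowerSeries.substAlgHom_apply ha, map_zero, zero_mul]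

theorem taylorRow_eq_sum (y y' : (Fin d → ℕ) → MvPowerSeries (Coord d Λ) K) (l : Option Λ)
    (k : MI (Fin d → ℕ)) {k' : MI (Fin d → ℕ)} {F : Finset (MI (Fin d → ℕ))}
    (hF : ∀ j ≤ k', j ∈ F) : S.taylorRow y' l k k' =
      ∑ j ∈ F, taylorCoeff (fun n => y' n - y n) j k * S.taylorRow y l j k' := by
  simp only [taylorRow]
  split_ifs
  · have hadd : (fun n => y' n - MvPowerSeries.X (Sum.inr n)) =
        (fun n => y' n - y n) + fun n => y n - MvPowerSeries.X (Sum.inr n) := by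
      ext1 n
      exact (sub_add_sub_cancel _ _ _).symm
    rw [hadd, taylorCoeff_add _ _ hF]
    exact Finset.sum_congr rfl fun j _ => mul_comm _ _
  · simp only [mul_zero, Finset.sum_const_zero]

theorem subst_translVar (ha : MvPowerSeries.HasSubst (S.translVar y₂)) (x : Coord d Λ) :
    MvPowerSeries.subst (S.translVar y₂) (S.translVar y₁ x) =
      S.translVar (fun n => MvPowerSeries.subst (S.translVar y₂) (y₁ n)) x := by
  classical
  rcases x with ⟨l, k⟩ | n
  · by_cases hs : S.Subcritical l k
    · rw [translVar_inl_of_subcritical S _ hs, translVar_inl_of_subcritical S _ hs]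
      ext β
      have hfin : (⋃ k' ∈ inlEmb d l ⁻¹' (β.support : Set (Coord d Λ)), Set.Iic k').Finite :=
        (β.support.finite_toSet.preimage (inlEmb d l).injective.injOn).biUnion
          fun k' _ => Set.finite_Iic k'
      obtain ⟨F₀, hF₀⟩ := exists_coeff_subst_varSum (A := K) ha (inlEmb d l) β
      rw [hF₀ (F₀ ∪ hfin.toFinset) Finset.subset_union_left]
      simp only [inlEmb_apply, subst_taylorRow_mul_translVar S ha]
      rw [← map_sum, ← map_sum]
      refine coeff_varSum_congr _ fun k' hk' => ?_
      rw [taylorRow_eq_sum S y₂ _ l k (F := F₀ ∪ hfin.toFinset), Finset.sum_apply]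
      · rfl
      · exact fun j hj => Finset.mem_union_right _ (hfin.mem_toFinset.2
          (Set.mem_biUnion (Finsupp.mem_support_iff.2 hk') hj))
    · rw [translVar_inl_of_not_subcritical S _ hs, translVar_inl_of_not_subcritical S _ hs,
        MvPowerSeries.subst_X ha, translVar_inl_of_not_subcritical S _ hs]
  · rfl

theorem subst_transl [Algebra ℝ K] (ha : MvPowerSeries.HasSubst (S.translVar y₂))
    (f : Poly d Λ) : MvPowerSeries.subst (S.translVar y₂) (S.transl y₁ f) =
      S.transl (fun n => MvPowerSeries.subst (S.translVar y₂) (y₁ n)) f := by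
  have hcomp : ((MvPowerSeries.substAlgHom ha).restrictScalars ℝ).comp (S.transl y₁) =
      S.transl fun n => MvPowerSeries.subst (S.translVar y₂) (y₁ n) := by
    refine MvPolynomial.algHom_ext fun x => ?_
    rw [AlgHom.comp_apply, transl_X, transl_X, AlgHom.restrictScalars_apply,
      MvPowerSeries.substAlgHom_apply, subst_translVar S ha]
  rw [← hcomp, AlgHom.comp_apply, AlgHom.restrictScalars_apply, MvPowerSeries.substAlgHom_apply]

variable {y : (Fin d → ℕ) → MvPowerSeries (Coord d Λ) K} [Algebra ℝ K]

theorem transl_monomial_one (δ : MI (Coord d Λ)) :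
    S.transl y (MvPolynomial.monomial δ 1) = δ.prod fun x j => S.translVar y x ^ j := by
  rw [transl, MvPolynomial.aeval_monomial, map_one, one_mul]

theorem transl_monomial_single (n : Fin d → ℕ) :
    S.transl y (MvPolynomial.monomial (Finsupp.single (Sum.inr n) 1) 1) = y n :=
  S.transl_X y (Sum.inr n)

theorem finite_support_coeff_transl (ha : MvPowerSeries.HasSubst (S.translVar y))
    (β : MI (Coord d Λ)) : (Function.support fun δ =>
      MvPowerSeries.coeff β (S.transl y (MvPolynomial.monomial δ 1))).Finite := by
  let ones : MvPowerSeries (Coord d Λ) K := fun _ => 1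
  have hones (δ : MI (Coord d Λ)) : MvPowerSeries.coeff δ ones = 1 := rfl
  refine (MvPowerSeries.coeff_subst_finite ha ones β).subset fun δ hδ => ?_
  rw [Function.mem_support, hones, one_smul, ← transl_monomial_one]
  exact hδ

theorem coeff_subst_translVar (ha : MvPowerSeries.HasSubst (S.translVar y))
    (f : MvPowerSeries (Coord d Λ) K) (β : MI (Coord d Λ)) :
    MvPowerSeries.coeff β (MvPowerSeries.subst (S.translVar y) f) =
      ∑ᶠ δ, MvPowerSeries.coeff δ f *
        MvPowerSeries.coeff β (S.transl y (MvPolynomial.monomial δ 1)) := by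
  simp only [MvPowerSeries.coeff_subst ha, transl_monomial_one, smul_eq_mul]

end Subst

end Setting

theorem exists_unitriangular_solution {I A : Type*} [CommRing A] {s : Set I} {r : I → I → Prop}
    (hr : s.WellFoundedOn r) {c : I → I → A} (hfin : ∀ β ∈ s, (Function.support (c β)).Finite)
    (hdiag : ∀ β ∈ s, c β β = 1) (hoff : ∀ β ∈ s, ∀ δ ∈ s, δ ≠ β → c β δ ≠ 0 → r δ β)
    (g : I → A) :
    ∃ u : I → A, Function.support u ⊆ s ∧ ∀ β ∈ s, ∑ᶠ δ, u δ * c β δ = g β := by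
  classical
  have hwf := Set.wellFoundedOn_iff.1 hr
  let step (β : I) (u : ∀ δ, r δ β ∧ δ ∈ s ∧ β ∈ s → A) : A := if β ∈ s then
    g β - ∑ᶠ δ, if h : (r δ β ∧ δ ∈ s ∧ β ∈ s) ∧ δ ≠ β then u δ h.1 * c β δ else 0 else 0
  let u : I → A := hwf.fix step
  have hu (β : I) : u β = step β fun δ _ => u δ := hwf.fix_eq step β
  have hsupp : Function.support u ⊆ s := fun β hβ => by
    by_contra hβs
    exact hβ ((hu β).trans (if_neg hβs))
  refine ⟨u, hsupp, fun β hβ => ?_⟩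
  let v (δ : I) : A := if (r δ β ∧ δ ∈ s ∧ β ∈ s) ∧ δ ≠ β then u δ * c β δ else 0
  have hv : u β = g β - ∑ᶠ δ, v δ := (hu β).trans (if_pos hβ)
  have hsplit (δ : I) : u δ * c β δ = v δ + if δ = β then u β else 0 := by
    by_cases hδβ : δ = β
    · rw [hδβ, hdiag β hβ, if_pos rfl, mul_one, right_eq_add]
      exact if_neg fun h => h.2 rfl
    · rw [if_neg hδβ, add_zero]
      refine (ite_eq_left_iff.2 fun h => ?_).symm
      by_contra hne
      have hδ : δ ∈ s := hsupp (left_ne_zero_of_mul (Ne.symm hne))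
      exact h ⟨⟨hoff β hβ δ hδ hδβ (right_ne_zero_of_mul (Ne.symm hne)), hδ, hβ⟩, hδβ⟩
  have hvfin : (Function.support v).Finite := (hfin β hβ).subset fun δ hδ =>
    right_ne_zero_of_mul (ite_ne_right_iff.1 hδ).2
  have hdiagfin : (Function.support fun δ => if δ = β then u β else 0).Finite :=
    (Set.finite_singleton β).subset fun δ hδ => (ite_ne_right_iff.1 hδ).1
  rw [finsum_congr hsplit, finsum_add_distrib hvfin hdiagfin,
    finsum_eq_single _ β fun δ hδ => if_neg hδ, if_pos rfl, hv, add_sub_cancel]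

namespace Setting

variable (S : Setting d Λ)

/-- The parameters of the composition of the translations with parameters `w₁` and `w₂`. -/
def compParam (w₁ w₂ : S.MPlus ⊕ Fin d → ℝ) : S.MPlus ⊕ Fin d → ℝ :=
  Sum.elim (fun x => MvPowerSeries.coeff x.1.1.1
      (MvPowerSeries.subst (S.translVar (S.shiftedCoord w₂)) (S.shiftedCoord w₁ x.1.2)))
    fun i => w₁ (Sum.inr i) + w₂ (Sum.inr i)

variable {S} {w w₁ w₂ : S.MPlus ⊕ Fin d → ℝ} {n : Fin d → ℕ} {δ β γ : MI (Coord d Λ)}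

theorem mem_of_coeff_shiftedCoord_ne_zero
    (h : MvPowerSeries.coeff δ (S.shiftedCoord w n) ≠ 0) :
    (∃ n', n ≤ n' ∧ δ = Finsupp.single (Sum.inr n') 1) ∨
      (δ ∈ S.N ∧ S.deg n < S.η + S.hom δ) := by
  by_cases hP : δ ∈ P d Λ
  · obtain ⟨n', rfl⟩ := hP
    refine Or.inl ⟨n', ?_, rfl⟩
    dsimp only at h
    rw [coeff_shiftedCoord_single] at h
    by_contra hn
    exact h (taylorCoeff_eq_zero _ fun h' => hn h')
  · by_contra h'
    exact h (S.coeff_shiftedCoord_of_not w hP fun h'' => h' (Or.inr h''))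

variable (w₁ w₂ n) in
theorem coeff_single_subst_shiftedCoord (n' : Fin d → ℕ) :
    MvPowerSeries.coeff (Finsupp.single (Sum.inr n') 1)
      (MvPowerSeries.subst (S.translVar (S.shiftedCoord w₂)) (S.shiftedCoord w₁ n)) =
      taylorCoeff ((fun i => w₁ (Sum.inr i)) + fun i => w₂ (Sum.inr i)) (toMI n') (toMI n) := by
  classical
  have hinj : Function.Injective fun j : MI (Fin d) =>
      (Finsupp.single (Sum.inr (j : Fin d → ℕ)) 1 : MI (Coord d Λ)) :=
    fun j j' h => DFunLike.coe_injective (single_inr_injective h)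
  have hIic (j : MI (Fin d)) (hj : j ≤ toMI n') : j ∈ (Set.finite_Iic (toMI n')).toFinset :=
    (Set.finite_Iic _).mem_toFinset.2 hj
  rw [coeff_subst_translVar S (S.hasSubst_translVar_shiftedCoord w₂), taylorCoeff_add _ _ hIic]
  rw [finsum_eq_sum_of_support_subset (s := (Set.finite_Iic (toMI n')).toFinset.image
    fun j : MI (Fin d) => Finsupp.single (Sum.inr (j : Fin d → ℕ)) 1), Finset.sum_image hinj.injOn]
  · refine Finset.sum_congr rfl fun j _ => ?_
    rw [coeff_shiftedCoord_single, transl_monomial_single, coeff_shiftedCoord_single, mul_comm,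
      show toMI (j : Fin d → ℕ) = j from Finsupp.equivFunOnFinite.symm_apply_apply j]
  · intro δ hδ
    have htransl := right_ne_zero_of_mul hδ
    rcases mem_of_coeff_shiftedCoord_ne_zero (left_ne_zero_of_mul hδ) with ⟨m, -, rfl⟩ | ⟨hδN, -⟩
    · rw [Finset.coe_image]
      refine ⟨toMI m, hIic _ ?_, rfl⟩
      rw [transl_monomial_single, coeff_shiftedCoord_single] at htransl
      by_contra hle
      exact htransl (taylorCoeff_eq_zero _ hle)
    · exact absurd (S.mem_N_of_coeff_transl_ne_zero htransl hδN) (S.single_inr_notMem_N n')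

theorem mem_of_coeff_subst_shiftedCoord_ne_zero (hβ : β ∉ P d Λ)
    (h : MvPowerSeries.coeff β
      (MvPowerSeries.subst (S.translVar (S.shiftedCoord w₂)) (S.shiftedCoord w₁ n)) ≠ 0) :
    β ∈ S.N ∧ S.deg n < S.η + S.hom β := by
  rw [coeff_subst_translVar S (S.hasSubst_translVar_shiftedCoord w₂)] at h
  obtain ⟨δ, hδ⟩ := not_forall.1 (mt finsum_eq_zero_of_forall_eq_zero h)
  have htransl := right_ne_zero_of_mul hδ
  rcases mem_of_coeff_shiftedCoord_ne_zero (left_ne_zero_of_mul hδ) with ⟨m, hm, rfl⟩ | ⟨hδN, hdeg⟩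
  · rw [transl_monomial_single] at htransl
    rcases mem_of_coeff_shiftedCoord_ne_zero htransl with ⟨m', -, rfl⟩ | ⟨hβN, hdeg⟩
    · exact absurd ⟨m', rfl⟩ hβ
    · exact ⟨hβN, (S.deg_mono hm).trans_lt hdeg⟩
  · exact ⟨S.mem_N_of_coeff_transl_ne_zero htransl hδN,
      hdeg.trans_le (add_le_add_right (S.hom_le_of_coeff_transl_ne_zero htransl) _)⟩

variable (w₁ w₂ n) in
theorem subst_shiftedCoord :
    MvPowerSeries.subst (S.translVar (S.shiftedCoord w₂)) (S.shiftedCoord w₁ n) =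
      S.shiftedCoord (S.compParam w₁ w₂) n :=
  S.eq_shiftedCoord (coeff_single_subst_shiftedCoord w₁ w₂ n) (fun _ _ _ => rfl) fun _ hβ h =>
    not_not.1 fun hne => h (mem_of_coeff_subst_shiftedCoord_ne_zero hβ hne)

theorem mem_Pop_of_coeff_transl_ne_zero
    (h : MvPowerSeries.coeff β (S.transl (S.shiftedCoord w) (MvPolynomial.monomial γ 1)) ≠ 0)
    (hγ : γ ∈ S.Pop) : β ∈ S.Pop := by
  rcases hγ with ⟨n, rfl⟩ | hγ
  · dsimp only at h
    rw [transl_monomial_single] at h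
    rcases mem_of_coeff_shiftedCoord_ne_zero h with ⟨n', -, rfl⟩ | h
    · exact Or.inl ⟨n', rfl⟩
    · exact Or.inr h.1
  · exact Or.inr (S.mem_N_of_coeff_transl_ne_zero h hγ)

variable (w) in
theorem exists_coeff_subst_noisePart [Finite Λ] (n : Fin d → ℕ) (g : MI (Coord d Λ) → ℝ) :
    ∃ u : S.MPlus → ℝ, ∀ β ∈ S.N, S.deg n < S.η + S.hom β →
      MvPowerSeries.coeff β
        (MvPowerSeries.subst (S.translVar (S.shiftedCoord w)) (S.noisePart u n)) = g β := by
  classical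
  have ha := S.hasSubst_translVar_shiftedCoord w
  let s : Set (MI (Coord d Λ)) := {β | β ∈ S.N ∧ S.deg n < S.η + S.hom β}
  obtain ⟨u, hsupp, hu⟩ := exists_unitriangular_solution (s := s)
    (c := fun β δ => MvPowerSeries.coeff β
      (S.transl (S.shiftedCoord w) (MvPolynomial.monomial δ 1)))
    (S.wellFoundedOn_hom.subset fun β hβ => hβ.1)
    (fun β _ => S.finite_support_coeff_transl ha β)
    (fun β _ => by rw [coeff_transl_of_not_lt S w (lt_irrefl _), MvPolynomial.coeff_monomial,
      if_pos rfl])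
    (fun β _ δ _ hδβ hne => by
      by_contra hlt
      rw [coeff_transl_of_not_lt S w hlt, MvPolynomial.coeff_monomial, if_neg hδβ] at hne
      exact hne rfl) g
  have hcoeff (δ : MI (Coord d Λ)) :
      MvPowerSeries.coeff δ (S.noisePart (fun x => u x.1.1.1) n) = u δ := by
    by_cases hδ : δ ∈ s
    · exact S.coeff_noisePart _ hδ.1 hδ.2
    · rw [coeff_noisePart_of_not S _ hδ, Function.notMem_support.1 fun h => hδ (hsupp h)]
  refine ⟨fun x => u x.1.1.1, fun β hβ hdeg => ?_⟩
  rw [coeff_subst_translVar S ha, ← hu β ⟨hβ, hdeg⟩]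
  simp only [hcoeff]

theorem exists_compParam_eq_zero [Finite Λ] (w₂ : S.MPlus ⊕ Fin d → ℝ) :
    ∃ w₁, S.compParam w₁ w₂ = 0 := by
  have ha := S.hasSubst_translVar_shiftedCoord w₂
  let h₁ : Fin d → ℝ := fun i => -w₂ (Sum.inr i)
  choose u hu using fun n => exists_coeff_subst_noisePart w₂ n fun β => -MvPowerSeries.coeff β
    (MvPowerSeries.subst (S.translVar (S.shiftedCoord w₂)) (polyCoord Λ h₁ n))
  refine ⟨Sum.elim (fun x => u x.1.2 x) h₁, ?_⟩
  ext x
  rcases x with ⟨⟨β, n⟩, hx⟩ | i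
  · have hnoise : S.noisePart (fun x => u x.1.2 x) n = S.noisePart (u n) n := by
      ext δ
      by_cases hδ : δ ∈ S.N ∧ S.deg n < S.η + S.hom δ
      · rw [coeff_noisePart S _ hδ.1 hδ.2, coeff_noisePart S _ hδ.1 hδ.2]
      · rw [coeff_noisePart_of_not S _ hδ, coeff_noisePart_of_not S _ hδ]
    change MvPowerSeries.coeff β.1 (MvPowerSeries.subst (S.translVar (S.shiftedCoord w₂))
      (polyCoord Λ h₁ n + S.noisePart (fun x => u x.1.2 x) n)) = 0
    rw [hnoise, MvPowerSeries.subst_add ha, map_add, hu n β β.2 hx, add_neg_cancel]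
  · exact neg_add_cancel _

end Setting

/-! ### The structure group -/

theorem exists_subgroup_units_val_image_eq {M : Type*} [Monoid M] {s : Set M} (one_mem : 1 ∈ s)
    (mul_mem : ∀ a ∈ s, ∀ b ∈ s, a * b ∈ s) (exists_left_inv : ∀ a ∈ s, ∃ b ∈ s, b * a = 1) :
    ∃ H : Subgroup Mˣ, s = Units.val '' (H : Set Mˣ) := by
  have hinv (a : M) (ha : a ∈ s) : ∃ b ∈ s, b * a = 1 ∧ a * b = 1 := by
    obtain ⟨b, hb, hba⟩ := exists_left_inv a ha
    obtain ⟨c, -, hcb⟩ := exists_left_inv b hb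
    exact ⟨b, hb, hba, left_inv_eq_right_inv hcb hba ▸ hcb⟩
  refine ⟨{ carrier := Units.val ⁻¹' s
            mul_mem' := fun {u v} hu hv => mul_mem u hu v hv
            one_mem' := one_mem
            inv_mem' := fun {u} hu => ?_ }, ?_⟩
  · obtain ⟨b, hb, hbu, -⟩ := hinv u hu
    change (u⁻¹).val ∈ s
    rwa [Units.inv_eq_of_mul_eq_one_left hbu]
  · refine Set.Subset.antisymm (fun a ha => ?_) (Set.image_subset_iff.2 subset_rfl)
    obtain ⟨b, -, hba, hab⟩ := hinv a ha
    exact ⟨⟨a, b, hab, hba⟩, ha, rfl⟩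

theorem linearMap_finsupp_apply_eq_sum {R I I' : Type*} [CommSemiring R]
    (f : (I →₀ R) →ₗ[R] I' →₀ R) (v : I →₀ R) (j : I') :
    f v j = v.sum fun i t => t * f (Finsupp.single i 1) j := by
  have hv : v = v.sum fun i t => t • Finsupp.single i 1 := by
    simp only [Finsupp.smul_single_one, Finsupp.sum_single]
  conv_lhs => rw [hv]
  simp only [Finsupp.sum, map_sum, map_smul, Finsupp.finsetSum_apply, Finsupp.smul_apply,
    smul_eq_mul]

theorem sumElim_toMI_bijective {I : Type*} :
    Function.Bijective fun q : MI I × (Fin d → ℕ) => Finsupp.sumElim q.1 (toMI q.2) :=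
  Finsupp.sumFinsuppEquivProdFinsupp.symm.bijective.comp
    (Function.bijective_id.prodMap Finsupp.equivFunOnFinite.symm.bijective)

namespace Setting

variable (S : Setting d Λ)

theorem finite_actCoeffPlus (β : S.All) : {q : (MI S.MPlus × (Fin d → ℕ)) × S.All |
    S.actCoeffPlus q.1.1 q.1.2 β q.2 ≠ 0}.Finite := by
  let coeffTransl (γ : MI (Coord d Λ)) : S.TPlus :=
    MvPowerSeries.coeff β.1 (S.univTransl (MvPolynomial.monomial γ 1))
  have hfin : (Function.support coeffTransl).Finite :=
    S.finite_support_coeff_transl (S.hasSubst_translVar_shiftedCoord MvPolynomial.X) β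
  let exponents (q : (MI S.MPlus × (Fin d → ℕ)) × S.All) :
      Σ _ : MI (Coord d Λ), MI (S.MPlus ⊕ Fin d) := ⟨q.2, Finsupp.sumElim q.1.1 (toMI q.1.2)⟩
  have hexponents : Function.Injective exponents := fun q q' h => by
    obtain ⟨hγ, hQ⟩ := Sigma.mk.inj_iff.1 h
    exact Prod.ext (sumElim_toMI_bijective.1 (eq_of_heq hQ)) (Subtype.ext hγ)
  refine Set.Finite.of_finite_image ((hfin.toFinset.sigma fun γ =>
    (coeffTransl γ).support).finite_toSet.subset ?_) hexponents.injOn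
  rintro _ ⟨q, hq, rfl⟩
  have hcoeff : (coeffTransl q.2).coeff (Finsupp.sumElim q.1.1 (toMI q.1.2)) ≠ 0 := by
    rw [← actCoeffPlus_eq_coeff_univTransl]
    exact hq
  rw [Finset.mem_coe, Finset.mem_sigma, Set.Finite.mem_toFinset, MvPolynomial.mem_support_iff]
  exact ⟨fun h => hcoeff (by rw [h, MvPolynomial.coeff_zero]), hcoeff⟩

open Classical in
theorem coeff_ZMon (J J' : MI S.MPlus) (m m' : Fin d → ℕ) :
    (S.ZMon J m).coeff (Finsupp.sumElim J' (toMI m')) = if (J, m) = (J', m') then 1 else 0 := by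
  have hmonomial : S.ZMon J m = MvPolynomial.monomial (Finsupp.sumElim J (toMI m)) 1 := by
    rw [MvPolynomial.monomial_eq, Finsupp.prod_sumElim, ZMon, map_one, one_mul,
      Finsupp.prod_fintype (toMI m) _ fun _ => by simp only [Function.comp_apply, pow_zero]]
    rfl
  rw [hmonomial, MvPolynomial.coeff_monomial]
  exact if_congr (sumElim_toMI_bijective.1.eq_iff (a := (J, m)) (b := (J', m'))) rfl rfl

open Classical in
theorem coeff_univTransl_eq_sum (β : S.All) (γ : S.All) :
    MvPowerSeries.coeff β.1 (S.univTransl (MvPolynomial.monomial γ.1 1)) =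
      ∑ q ∈ (S.finite_actCoeffPlus β).toFinset, S.actCoeffPlus q.1.1 q.1.2 β q.2 •
        if q.2 = γ then S.ZMon q.1.1 q.1.2 else 0 := by
  ext Q
  obtain ⟨⟨J, m⟩, rfl⟩ := sumElim_toMI_bijective.2 Q
  rw [← actCoeffPlus_eq_coeff_univTransl, MvPolynomial.coeff_sum,
    Finset.sum_eq_single ((J, m), γ)]
  · rw [if_pos rfl, MvPolynomial.coeff_smul, coeff_ZMon, if_pos rfl, smul_eq_mul, mul_one]
  · rintro ⟨⟨J', m'⟩, γ'⟩ - hne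
    rw [MvPolynomial.coeff_smul]
    split_ifs with hγ
    · rw [coeff_ZMon, if_neg fun h => hne (Prod.ext h hγ), smul_zero]
    · rw [MvPolynomial.coeff_zero, smul_zero]
  · intro hq
    rw [Set.Finite.mem_toFinset, Set.mem_ofPred_eq, not_not] at hq
    rw [hq, zero_smul, MvPolynomial.coeff_zero]

theorem coaction_single (β : S.All) :
    S.coaction (Finsupp.single β 1) = ∑ q ∈ (S.finite_actCoeffPlus β).toFinset,
      S.actCoeffPlus q.1.1 q.1.2 β q.2 •
        (S.ZMon q.1.1 q.1.2 ⊗ₜ[ℝ] Finsupp.single q.2 (1 : ℝ)) := by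
  rw [coaction, Finsupp.linearCombination_single, one_smul]
  refine finsum_eq_sum_of_support_subset _ fun q hq => ?_
  rw [Set.Finite.coe_toFinset]
  exact left_ne_zero_of_smul hq

theorem Gam_single (w : S.MPlus ⊕ Fin d → ℝ) (β γ : S.Pop) :
    S.Gam (MvPolynomial.aeval w) (Finsupp.single β 1) γ =
      MvPowerSeries.coeff β.1 (S.transl (S.shiftedCoord w) (MvPolynomial.monomial γ.1 1)) := by
  classical
  have hproj (γ' : S.All) :
      S.projPop (Finsupp.single γ' 1) γ = if γ' = S.popIncl γ then 1 else 0 :=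
    Finsupp.single_apply
  rw [coeff_transl_eq_aeval]
  change _ = MvPolynomial.aeval w (MvPowerSeries.coeff (S.popIncl β).1
    (S.univTransl (MvPolynomial.monomial (S.popIncl γ).1 1)))
  rw [coeff_univTransl_eq_sum, map_sum, Gam, projCoaction]
  simp only [LinearMap.comp_apply, Finsupp.lmapDomain_apply, Finsupp.mapDomain_single,
    coaction_single, map_sum, map_smul, LinearMap.lTensor_tmul, LinearMap.rTensor_tmul,
    LinearEquiv.coe_coe, TensorProduct.lid_tmul, Finsupp.finsetSum_apply, Finsupp.smul_apply, hproj]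
  refine Finset.sum_congr rfl fun q _ => congrArg _ ?_
  split_ifs
  · exact mul_one _
  · rw [smul_zero, map_zero]

theorem Gam_mul (w₁ w₂ : S.MPlus ⊕ Fin d → ℝ) :
    S.Gam (MvPolynomial.aeval w₁) * S.Gam (MvPolynomial.aeval w₂) =
      S.Gam (MvPolynomial.aeval (S.compParam w₁ w₂)) := by
  refine Finsupp.lhom_ext' fun β => LinearMap.ext_ring (Finsupp.ext fun γ => ?_)
  change S.Gam (MvPolynomial.aeval w₁) (S.Gam (MvPolynomial.aeval w₂) (Finsupp.single β 1)) γ =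
    S.Gam (MvPolynomial.aeval (S.compParam w₁ w₂)) (Finsupp.single β 1) γ
  let c (δ : MI (Coord d Λ)) : ℝ :=
    MvPowerSeries.coeff δ (S.transl (S.shiftedCoord w₁) (MvPolynomial.monomial γ.1 1)) *
      MvPowerSeries.coeff β.1 (S.transl (S.shiftedCoord w₂) (MvPolynomial.monomial δ 1))
  have hPop : Function.support c ⊆ S.Pop := fun δ hδ =>
    mem_Pop_of_coeff_transl_ne_zero (left_ne_zero_of_mul hδ) γ.2
  have ha := S.hasSubst_translVar_shiftedCoord w₂
  calc
    _ = ∑ δ ∈ (S.Gam (MvPolynomial.aeval w₂) (Finsupp.single β 1)).support, c δ := by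
      rw [linearMap_finsupp_apply_eq_sum]
      refine Finset.sum_congr rfl fun δ _ => ?_
      beta_reduce
      rw [Gam_single, Gam_single, mul_comm]
    _ = ∑ᶠ δ : S.Pop, c δ := by
      refine (finsum_eq_sum_of_support_subset _ fun δ hδ => ?_).symm
      rw [Finset.mem_coe, Finsupp.mem_support_iff, Gam_single]
      exact right_ne_zero_of_mul hδ
    _ = ∑ᶠ δ, c δ := by
      rw [finsum_set_coe_eq_finsum_mem, finsum_mem_def, Set.indicator_eq_self.2 hPop]
    _ = _ := by
      rw [Gam_single, ← coeff_subst_translVar S ha, subst_transl S ha]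
      simp only [subst_shiftedCoord]

theorem Gam_zero : S.Gam (MvPolynomial.aeval 0) = 1 := by
  classical
  refine Finsupp.lhom_ext' fun β => LinearMap.ext_ring (Finsupp.ext fun γ => ?_)
  change S.Gam (MvPolynomial.aeval 0) (Finsupp.single β 1) γ = Finsupp.single β (1 : ℝ) γ
  rw [Gam_single, shiftedCoord_zero, coeff_transl_X, MvPolynomial.coeff_monomial,
    Finsupp.single_apply]
  exact if_congr (eq_comm.trans Subtype.ext_iff.symm) rfl rfl

theorem isGroup_G [Finite Λ] :
    ∃ H : Subgroup (Module.End ℝ S.TPop)ˣ, S.G = Units.val '' (H : Set (Module.End ℝ S.TPop)ˣ) := by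
  have hparam {Γ : Module.End ℝ S.TPop} (hΓ : Γ ∈ S.G) : ∃ w, S.Gam (MvPolynomial.aeval w) = Γ :=
    hΓ.imp' _ fun π hπ => (congrArg S.Gam (MvPolynomial.aeval_unique π)).symm.trans hπ
  refine exists_subgroup_units_val_image_eq ⟨_, S.Gam_zero⟩ (fun Γ₁ h₁ Γ₂ h₂ => ?_) fun Γ h => ?_
  · obtain ⟨w₁, rfl⟩ := hparam h₁
    obtain ⟨w₂, rfl⟩ := hparam h₂
    exact ⟨_, (S.Gam_mul w₁ w₂).symm⟩
  · obtain ⟨w₂, rfl⟩ := hparam h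
    obtain ⟨w₁, hw⟩ := exists_compParam_eq_zero w₂
    exact ⟨_, ⟨MvPolynomial.aeval w₁, rfl⟩, by rw [Gam_mul, hw, Gam_zero]⟩

theorem hom_lt_of_Gam_sub_one (π : S.TPlus →ₐ[ℝ] ℝ) (β γ : S.Pop)
    (h : (S.Gam π - 1 : Module.End ℝ S.TPop) (Finsupp.single β 1) γ ≠ 0) :
    S.hom γ < S.hom β := by
  classical
  contrapose! h
  rw [LinearMap.sub_apply, Finsupp.sub_apply, MvPolynomial.aeval_unique π, Gam_single,
    coeff_transl_of_not_lt S _ h.not_gt, MvPolynomial.coeff_monomial, Module.End.one_apply,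
    Finsupp.single_apply, sub_eq_zero]
  exact if_congr (eq_comm.trans Subtype.ext_iff.symm) rfl rfl

theorem iSup_graded (p : S.A → Prop) : ⨆ ν : S.A, ⨆ _ : p ν, S.graded ν =
    Finsupp.supported ℝ ℝ {β : S.Pop | ∃ ν, p ν ∧ S.hom β + S.η = ν} := by
  have hUnion : {β : S.Pop | ∃ ν : S.A, p ν ∧ S.hom β + S.η = ν} =
      ⋃ ν : {ν : S.A // p ν}, {β : S.Pop | S.hom β + S.η = ν.1} := by
    ext β
    simp
  rw [hUnion, Finsupp.supported_iUnion, iSup_subtype']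
  rfl

theorem triangular_G (Γ : Module.End ℝ S.TPop) (hΓ : Γ ∈ S.G) (ν : S.A) (a : S.TPop)
    (ha : a ∈ S.graded ν) : Γ a - a ∈ ⨆ ν' : S.A, ⨆ _ : ν' < ν, S.graded ν' := by
  obtain ⟨π, rfl⟩ := hΓ
  rw [iSup_graded, Finsupp.mem_supported]
  intro γ hγ
  have hsub : S.Gam π a - a = (S.Gam π - 1 : Module.End ℝ S.TPop) a := rfl
  rw [Finset.mem_coe, Finsupp.mem_support_iff, hsub, linearMap_finsupp_apply_eq_sum] at hγ
  obtain ⟨β, hβ, hne⟩ := Finset.exists_ne_zero_of_sum_ne_zero hγ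
  have hβν : S.hom β + S.η = ν := (Finsupp.mem_supported _ _).1 ha hβ
  have hlt := S.hom_lt_of_Gam_sub_one π β γ (right_ne_zero_of_mul hne)
  refine ⟨⟨S.hom γ + S.η, Or.inr ⟨γ.1, γ.2, rfl⟩⟩, ?_, rfl⟩
  rw [← Subtype.coe_lt_coe, ← hβν]
  exact add_lt_add_left hlt _

theorem isInternal_graded : DirectSum.IsInternal S.graded := by
  refine DirectSum.isInternal_submodule_of_iSupIndep_of_iSup_eq_top (fun ν => ?_) ?_
  · rw [iSup_graded]
    refine Finsupp.disjoint_supported_supported (Set.disjoint_left.2 ?_)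
    rintro β hβ ⟨ν', hν', hβ'⟩
    exact hν' (Subtype.ext (hβ'.symm.trans hβ))
  · have htop := S.iSup_graded fun _ => True
    simp only [iSup_pos] at htop
    rw [htop, eq_top_iff]
    exact fun a _ => (Finsupp.mem_supported _ _).2 fun β _ =>
      ⟨⟨S.hom β + S.η, Or.inr ⟨β.1, β.2, rfl⟩⟩, trivial, rfl⟩

end Setting

end MultiIndexRS

end

open MultiIndexRS in
theorem mainTheorem5 {d : ℕ} {Λ : Type*} [Finite Λ] (S : Setting d Λ) :
    -- for every β, only finitely many terms of the coaction are non-zero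
    (∀ β : S.All, {q : (MI S.MPlus × (Fin d → ℕ)) × S.All |
      S.actCoeffPlus q.1.1 q.1.2 β q.2 ≠ 0}.Finite) ∧
    IsRegularityStructure S.A S.graded S.G ∧
    (∀ (π : S.TPlus →ₐ[ℝ] ℝ) (β γ : S.Pop),
      (S.Gam π - 1 : Module.End ℝ S.TPop) (Finsupp.single β 1) γ ≠ 0 → S.hom γ < S.hom β) :=
  ⟨S.finite_actCoeffPlus,
    { bddBelow := S.bddBelow_A
      locallyFinite := fun _ b => (S.finite_A_le b).subset fun _ ht => ⟨ht.1, ht.2.2⟩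
      isInternal := S.isInternal_graded
      isGroup := S.isGroup_G
      triangular := S.triangular_G },
    S.hom_lt_of_Gam_sub_one⟩
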